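/- Let $\mathbb X\subset\mathbb R^d$ be measurable and let $\pi,q$ be probability densities on $\mathbb X$ with respect to Lebesgue measure (target and proposal). Put $\alpha(x,y)=\min\{1,\frac{\pi(y)q(x)}{\pi(x)q(y)}\}$ if $\pi(x)q(y)>0$ and $\alpha(x,y)=1$ otherwise. The stationary independent Metropolis chain is defined by $X_0\sim\pi$, $Y_i\sim q$, $U_i\sim \mathrm{Unif}[0,1]$, all independent, and $X_{i+1}=Y_i$ if $U_i<\alpha(X_i,Y_i)$, $X_{i+1}=X_i$ otherwise; its transition kernel is $P(x,dy)=\alpha(x,y)q(y)\,dy+\bigl(1-\int\alpha(x,z)q(z)\,dz\bigr)\delta_x(dy)$. For measurable $F:\mathbb X\to\mathbb R$ let $$\mu_{n,IM}=\frac1n\sum_{i<n}F(X_i),\qquad \mu_{n,IMCV}=\frac1n\sum_{i<n}\Bigl\{F(X_i)+\alpha(X_i,Y_i)\bigl(F(Y_i)-F(X_i)\bigr)-\bigl(F(Y_i)-\mathbb E_q[F]\bigr)\Bigr\},$$ $$\sigma_F^2=\mathbb E_\pi\bigl[(F-\mathbb E_\pi[F])^2\bigr],\qquad \sigma^2_{IM}=\lim_{n\to\infty}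 n\,\mathbb E\bigl[(\mu_{n,IM}-\mathbb E_\pi[F])^2\bigr],\qquad \sigma^2_{IMCV}=\lim_{n\to\infty}\mathrm{Var}\bigl[\sqrt n\,\mu_{n,IMCV}\bigr].$$ Let $\mathrm{KL}(q\|\pi)=\int q\log(q/\pi)\,dx$ (equal to $+\infty$ if $q\,dx\not\ll\pi\,dx$). Assume: (A1) the chain with kernel $P$ is $\psi$-irreducible and aperiodic, and $\pi$ is its unique invariant probability measure; (A2) there is a measurable $W:\mathbb X\to[1,\infty)$ with $\sup_{x}|F(x)|/W(x)<\infty$, $\int W^4\pi\,dx<\infty$ and $\int W^4q\,dx<\infty$; (A3) $w^\star=\sup_{x\in\mathbb X}\pi(x)/q(x)<\infty$. Then the limits $\sigma^2_{IM}$ and $\sigma^2_{IMCV}$ exist and are finite, and there is an $\epsilon>0$ such that $$\mathrm{KL}(q\|\pi)\le\epsilon\quad\Longrightarrow\quad \sigma^2_{IMCV}\le\sigma^2_F\le\sigma^2_{IM}.$$ Here $\epsilon$ depends only on $\sigma_F^2$, an upper bound for $w^\star$ and an upper bound for $\max\{\mathbb E_\pi[F^4],\mathbb E_q[F^4]\}$.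 Moreover there is a constant $K\ge 0$, depending only on the latter two bounds, such that $\sigma^2_{IMCV}\le K\,\delta^{1/4}$ for every $\delta\ge 0$ with $\mathrm{KL}(q\|\pi)\le\delta$. -/

import Mathlib

open MeasureTheory ProbabilityTheory Filter Topology
open scoped ENNReal NNReal

attribute [local instance] Measure.Subtype.measureSpace

namespace IndepMetropolis

noncomputable section

/-- The Lebesgue measure on a subset of a Euclidean space is s-finite. -/
instance instSFiniteSubtype {d : ℕ} (X : Set (EuclideanSpace ℝ (Fin d))) :
    SFinite (volume : Measure X) := by
  have h : SigmaFinite (volume : Measure X) := by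
    refine ⟨⟨⟨fun n => Subtype.val ⁻¹' spanningSets (volume : Measure (EuclideanSpace ℝ (Fin d))) n,
      fun _ => Set.mem_univ _, fun n => ?_, ?_⟩⟩⟩
    · refine lt_of_le_of_lt (Measure.comap_apply_le _ _ ?_)
        (lt_of_le_of_lt (measure_mono (Set.image_preimage_subset _ _))
          (measure_spanningSets_lt_top volume n))
      exact ((measurableSet_spanningSets volume n).preimage
        measurable_subtype_coe).nullMeasurableSet
    · rw [← Set.preimage_iUnion, iUnion_spanningSets, Set.preimage_univ]
  infer_instance

variable {S : Type*} [MeasureSpace S]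

/-- `p` is a probability density with respect to the reference measure `volume` of the state
space `S`. -/
structure IsProbDensity (p : S → ℝ) : Prop where
  measurable : Measurable p
  nonneg : ∀ x, 0 ≤ p x
  lintegral_eq_one : ∫⁻ x, ENNReal.ofReal (p x) = 1

/-- The measure `p(x) dx` with density `p`. -/
def law (p : S → ℝ) : Measure S := volume.withDensity fun x => ENNReal.ofReal (p x)

/-- The acceptance probability `α(x, y)` of the independent Metropolis algorithm with target
density `π` and proposal density `q`. It does not change when `π` is multiplied by a positive
constant. -/
def accept (π q : S → ℝ) (x y : S) : ℝ :=
  if 0 < π x * q y then min 1 (π y * q x / (π x * q y)) else 1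

lemma measurable_accept {π q : S → ℝ} (hπ : Measurable π) (hq : Measurable q) :
    Measurable (Function.uncurry (accept π q)) := by
  have h1 : Measurable fun z : S × S => π z.1 * q z.2 :=
    (hπ.comp measurable_fst).mul (hq.comp measurable_snd)
  have h2 : Measurable fun z : S × S => π z.2 * q z.1 :=
    (hπ.comp measurable_snd).mul (hq.comp measurable_fst)
  exact Measurable.ite (measurableSet_lt measurable_const h1)
    (measurable_const.min (h2.div h1)) measurable_const

/-- The transition kernel `P(x, dy) = α(x, y) q(y) dy + (1 - ∫ α(x, z) q(z) dz) δ_x(dy)` of the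
independent Metropolis algorithm (see `imKernel_apply`). -/
def imKernel [SFinite (volume : Measure S)] (π q : S → ℝ) : Kernel S S :=
  haveI : SFinite (law q) := by unfold law; infer_instance
  Kernel.withDensity (Kernel.const S (law q)) (fun x y => ENNReal.ofReal (accept π q x y)) +
    Kernel.withDensity Kernel.id
      (fun x _ => ENNReal.ofReal (1 - ∫ z, accept π q x z ∂(law q)))

lemma imKernel_apply [SFinite (volume : Measure S)] {π q : S → ℝ} (hπ : Measurable π)
    (hq : Measurable q) (x : S) :
    imKernel π q x = (law q).withDensity (fun y => ENNReal.ofReal (accept π q x y)) +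
      ENNReal.ofReal (1 - ∫ z, accept π q x z ∂(law q)) • Measure.dirac x := by
  have : SFinite (law q) := by unfold law; infer_instance
  have h1 : Measurable (Function.uncurry fun x y => ENNReal.ofReal (accept π q x y)) :=
    (measurable_accept hπ hq).ennreal_ofReal
  have h2 : Measurable fun x => ∫ z, accept π q x z ∂(law q) :=
    ((measurable_accept hπ hq).stronglyMeasurable.integral_prod_right).measurable
  have h3 : Measurable (Function.uncurry fun (x _ : S) =>
      ENNReal.ofReal (1 - ∫ z, accept π q x z ∂(law q))) :=
    ((measurable_const.sub h2).ennreal_ofReal).comp measurable_fst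
  simp only [imKernel, FunLike.coe_add, Pi.add_apply]
  rw [Kernel.withDensity_apply _ h1, Kernel.withDensity_apply _ h3]
  simp [Kernel.const_apply, Kernel.id_apply, withDensity_const]

/-- `ψ` is a maximal irreducibility measure of the kernel `P`. -/
structure IsMaximalIrreducibilityMeasure (P : Kernel S S) (ψ : Measure S) : Prop where
  sigmaFinite : SigmaFinite ψ
  ne_zero : ψ ≠ 0
  irreducible : Kernel.IsIrreducible ψ P
  maximal : ∀ φ : Measure S, SigmaFinite φ → Kernel.IsIrreducible φ P → φ ≪ ψ

/-- `D` is a `k`-cycle of the kernel `P`, up to a `ψ`-null set. -/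
structure IsCycle (P : Kernel S S) (ψ : Measure S) (k : ℕ) (D : ZMod k → Set S) : Prop where
  measurableSet : ∀ i, MeasurableSet (D i)
  disjoint : Pairwise fun i j => Disjoint (D i) (D j)
  step : ∀ i, ∀ x ∈ D i, P x (D (i + 1)) = 1
  null : ψ (⋃ i, D i)ᶜ = 0

/-- The independent Metropolis chain is `ψ`-irreducible and aperiodic, and the target is its unique
invariant probability measure. -/
structure IsErgodicIM [SFinite (volume : Measure S)] (π q : S → ℝ) : Prop where
  irreducible_aperiodic : ∃ ψ, IsMaximalIrreducibilityMeasure (imKernel π q) ψ ∧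
    ∀ k : ℕ, 2 ≤ k → ¬ ∃ D : ZMod k → Set S, IsCycle (imKernel π q) ψ k D
  invariant : Kernel.Invariant (imKernel π q) (law π)
  unique : ∀ ν : Measure S, IsProbabilityMeasure ν → Kernel.Invariant (imKernel π q) ν →
    ν = law π

/-- `F ∈ L^W_∞`: the weighted sup-norm `sup_x |F x| / W x` is finite. -/
def MemWeightedSup (W F : S → ℝ) : Prop :=
  Measurable F ∧ BddAbove (Set.range fun x => |F x| / W x)

/-- `f ∈ L_n^{π,q}`: both `∫ |f|^n π dx` and `∫ |f|^n q dx` are finite. -/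
def MemLBoth (n : ℕ) (π q f : S → ℝ) : Prop :=
  Measurable f ∧ Integrable (fun x => |f x| ^ n) (law π) ∧ Integrable (fun x => |f x| ^ n) (law q)

/-- `w* = sup_x π(x) / q(x)`, as an extended nonnegative number. -/
def wStar (π q : S → ℝ) : ℝ≥0∞ := ⨆ x, ENNReal.ofReal (π x) / ENNReal.ofReal (q x)

/-- `𝔼_p[F]`. -/
def expect (p F : S → ℝ) : ℝ := ∫ x, F x ∂(law p)

/-- `σ²_F = 𝔼_π[(F - 𝔼_π[F])²]`, the variance of i.i.d. sampling from the target. -/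
def sigmaSqF (π F : S → ℝ) : ℝ := ∫ x, (F x - expect π F) ^ 2 ∂(law π)

/-- The sources of randomness of the algorithm: an initial state, and for every step `i` a proposal
and an acceptance variable in `[0, 1]`. -/
abbrev Noise (S : Type*) : Type _ := S × (ℕ → S × unitInterval)

/-- The law of the noise of the stationary algorithm: the initial state has law `π`, the proposals
have law `q`, the acceptance variables are uniform on `[0, 1]`, and all are independent. -/
def noiseLaw (π q : S → ℝ) : Measure (Noise S) :=
  (law π).prod (Measure.infinitePi fun _ : ℕ => (law q).prod (volume : Measure unitInterval))

/-- The proposal `Y_i` made at step `i`. -/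
def proposal (i : ℕ) (ω : Noise S) : S := (ω.2 i).1

/-- The state `X_i` of the independent Metropolis chain: `X_{i+1} = Y_i` if `U_i < α(X_i, Y_i)`
and `X_{i+1} = X_i` otherwise. -/
def state (π q : S → ℝ) : ℕ → Noise S → S
  | 0, ω => ω.1
  | i + 1, ω =>
    if ((ω.2 i).2 : ℝ) < accept π q (state π q i ω) (proposal i ω) then proposal i ω
    else state π q i ω

/-- The ergodic average `μ_{n,IM}`. -/
def imEstimator (π q F : S → ℝ) (n : ℕ) (ω : Noise S) : ℝ :=
  (1 / n : ℝ) * ∑ i ∈ Finset.range n, F (state π q i ω)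

/-- The control variate estimator `μ_{n,IMCV}`. -/
def imcvEstimator (π q F : S → ℝ) (n : ℕ) (ω : Noise S) : ℝ :=
  (1 / n : ℝ) * ∑ i ∈ Finset.range n,
    (F (state π q i ω) +
      (accept π q (state π q i ω) (proposal i ω) * (F (proposal i ω) - F (state π q i ω)) -
        (F (proposal i ω) - expect q F)))

/-- `s` is the asymptotic variance `lim n 𝔼[(μ_{n,IM} - 𝔼_π[F])²]` of `μ_{n,IM}`. -/
def IsSigmaSqIM (π q F : S → ℝ) (s : ℝ) : Prop :=
  Tendsto (fun n : ℕ => n * ∫ ω, (imEstimator π q F n ω - expect π F) ^ 2 ∂(noiseLaw π q))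
    atTop (𝓝 s)

/-- `s` is the asymptotic variance `lim Var[√n μ_{n,IMCV}]` of `μ_{n,IMCV}`. -/
def IsSigmaSqIMCV (π q F : S → ℝ) (s : ℝ) : Prop :=
  Tendsto (fun n : ℕ => variance (fun ω => √(n : ℝ) * imcvEstimator π q F n ω) (noiseLaw π q))
    atTop (𝓝 s)

end

end IndepMetropolis

/-! The bound `π ≤ w q` makes the accepted moves alone dominate the target: `π ≤ w P(x, ·)` for
every `x` (`law_le_smul_map_step`). Hence `P` contracts centred functions in `L²(π)` by the factor
`1 - 1/w` (`integral_transOp_sq_le`). The covariances of a centred square-integrable functional of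
(state, innovation) then decay geometrically, so its asymptotic variance exists and is at most `1 +
2w` times its second moment (`exists_tendsto_sq_sum`).

Upper bound. Up to a constant, the summand of the control variate estimator is `(1 - α(X, Y)) (F X -
F Y)`, which vanishes where acceptance is certain. By Cauchy-Schwarz the square of its second moment
is at most the mean rejection probability times fourth moments of `F` (`sq_integral_cvTerm_sq_le`).
That probability is controlled by the `L¹(π)` distance of `q/π` from `1`, hence by the Hellinger
distance, hence by the square root of the divergence (`integral_one_sub_accept_le`). Two square
roots in succession produce the exponent `1/4`.

Lower bound. `P` is reversible, and positive on `L²(π)`: relative to `π ⊗ π` its accepted part has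
the density `min (q x / π x) (q y / π y)`, a positive semidefinite kernel, while its rejected part
is diagonal. All autocovariances of `F` are therefore nonnegative, and the lag-zero term alone gives
`σ²_F ≤ σ²_IM` (`exists_isSigmaSqIM`), whatever the divergence. -/

namespace IndepMetropolis

noncomputable section

/-! ### Stationary chains driven by i.i.d. innovations, and their Markov property. -/

section RandomMapping

variable {E Z : Type*} [MeasurableSpace E] [MeasurableSpace Z]

/-- Cauchy-Schwarz inequality for real square-integrable functions. -/
lemma sq_integral_mul_le {μ : Measure E} {f g : E → ℝ} (hf : MemLp f 2 μ) (hg : MemLp g 2 μ) :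
    (∫ x, f x * g x ∂μ) ^ 2 ≤ (∫ x, f x ^ 2 ∂μ) * ∫ x, g x ^ 2 ∂μ := by
  have hfg : Integrable (fun x => f x * g x) μ := hf.integrable_mul hg
  have key (t : ℝ) : 0 ≤ (∫ x, f x ^ 2 ∂μ) * (t * t) + (2 * ∫ x, f x * g x ∂μ) * t +
      ∫ x, g x ^ 2 ∂μ := by
    have h0 : 0 ≤ ∫ x, (t * f x + g x) ^ 2 ∂μ := integral_nonneg fun x => sq_nonneg _
    have h1 : ∫ x, (t * f x + g x) ^ 2 ∂μ =
        ∫ x, (t * t) * f x ^ 2 + (2 * t) * (f x * g x) + g x ^ 2 ∂μ := by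
      congr with x; ring
    rw [h1, integral_add ((hf.integrable_sq.const_mul _).fun_add (hfg.const_mul _))
      hg.integrable_sq,
      integral_add (hf.integrable_sq.const_mul _) (hfg.const_mul _), integral_const_mul,
      integral_const_mul] at h0
    linarith
  have := discrim_le_zero key
  rw [discrim] at this
  linarith

/-- Prepending an independent coordinate to an i.i.d. sequence gives an i.i.d. sequence. -/
lemma measurePreserving_natCons (ν : Measure Z) [IsProbabilityMeasure ν] :
    MeasurePreserving (fun p : Z × (ℕ → Z) => (fun n => Nat.casesOn n p.1 p.2 : ℕ → Z))
      (ν.prod (Measure.infinitePi fun _ : ℕ => ν)) (Measure.infinitePi fun _ : ℕ => ν) := by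
  have hm : Measurable (fun p : Z × (ℕ → Z) => (fun n => Nat.casesOn n p.1 p.2 : ℕ → Z)) := by
    refine measurable_pi_lambda _ fun n => ?_
    cases n with
    | zero => exact measurable_fst
    | succ n => exact (measurable_pi_apply n).comp measurable_snd
  refine ⟨hm, Measure.eq_infinitePi _ fun A t ht => ?_⟩
  rw [Measure.map_apply hm (MeasurableSet.pi A.countable_toSet fun i _ => ht i)]
  -- A cylinder pulls back to a rectangle: the condition at `0`, void if `0 ∉ A`, times the
  -- remaining conditions with indices shifted down by one.
  have hpre : (fun p : Z × (ℕ → Z) => (fun n => Nat.casesOn n p.1 p.2 : ℕ → Z)) ⁻¹'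
      (Set.pi A t) = (if 0 ∈ A then t 0 else Set.univ) ×ˢ
        Set.pi ((A.erase 0).image Nat.pred : Finset ℕ) (fun n => t (n + 1)) := by
    ext p
    simp only [Set.mem_preimage, Set.mem_pi, Set.mem_prod, Finset.mem_coe, Finset.mem_image,
      Finset.mem_erase]
    constructor
    · intro h
      refine ⟨?_, ?_⟩
      · split_ifs with h0
        · exact h 0 h0
        · trivial
      · rintro n ⟨m, ⟨hm0, hmA⟩, rfl⟩
        obtain ⟨k, rfl⟩ := Nat.exists_eq_succ_of_ne_zero hm0
        exact h _ hmA
    · rintro ⟨h0, h1⟩ n hn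
      cases n with
      | zero => simpa [hn] using h0
      | succ n => exact h1 n ⟨n + 1, ⟨by simp, hn⟩, rfl⟩
  rw [hpre, Measure.prod_prod, Measure.infinitePi_pi _ fun i _ => ht _, Finset.prod_image]
  · have : ∏ x ∈ A.erase 0, ν (t (x.pred + 1)) = ∏ x ∈ A.erase 0, ν (t x) := by
      refine Finset.prod_congr rfl fun x hx => ?_
      rw [Nat.pred_eq_sub_one, Nat.sub_add_cancel
        (Nat.one_le_iff_ne_zero.2 (Finset.ne_of_mem_erase hx))]
    rw [this]
    split_ifs with h0
    · exact Finset.mul_prod_erase A (fun x => ν (t x)) h0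
    · rw [measure_univ, one_mul, Finset.erase_eq_of_notMem h0]
  · intro a ha b hb hab
    have ha' := Finset.ne_of_mem_erase ha
    have hb' := Finset.ne_of_mem_erase hb
    simp only [Nat.pred_eq_sub_one] at hab
    omega

/-- Splitting off the head undoes the prepending map, so the composite below is the identity by
unfolding. -/
lemma measurePreserving_headTail (ν : Measure Z) [IsProbabilityMeasure ν] :
    MeasurePreserving (fun z : ℕ → Z => (z 0, fun n => z (n + 1)))
      (Measure.infinitePi fun _ : ℕ => ν) (ν.prod (Measure.infinitePi fun _ : ℕ => ν)) := by
  have hm : Measurable (fun z : ℕ → Z => (z 0, fun n => z (n + 1))) := by fun_prop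
  have hc := measurePreserving_natCons ν
  refine ⟨hm, ?_⟩
  conv_lhs => rw [← hc.map_eq]
  rw [Measure.map_map hm hc.measurable]
  exact Measure.map_id

/-- The law of the initial state and the i.i.d. innovations of a Markov chain. -/
abbrev chainLaw (μ : Measure E) (ν : Measure Z) : Measure (E × (ℕ → Z)) :=
  μ.prod (Measure.infinitePi fun _ : ℕ => ν)

/-- The first state of the chain together with the innovation of its first step. -/
def firstStep (ω : E × (ℕ → Z)) : E × Z := (ω.1, ω.2 0)

/-- The time shift of the Markov chain with random mapping representation `s`. -/
def chainShift (s : E × Z → E) (ω : E × (ℕ → Z)) : E × (ℕ → Z) :=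
  (s (firstStep ω), fun n => ω.2 (n + 1))

/-- The transition operator `f ↦ (x ↦ 𝔼[f (s (x, ζ))])`, where `ζ` has law `ν`. -/
def transOp (ν : Measure Z) (s : E × Z → E) (f : E → ℝ) (x : E) : ℝ := ∫ z, f (s (x, z)) ∂ν

/-- The expectation of a functional of the chain started at a given state. -/
def expectFrom (ν : Measure Z) (ψ : E × (ℕ → Z) → ℝ) (x : E) : ℝ :=
  ∫ z, ψ (x, z) ∂(Measure.infinitePi fun _ : ℕ => ν)

variable {μ : Measure E} {ν : Measure Z} [IsProbabilityMeasure μ] [IsProbabilityMeasure ν]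
  {s : E × Z → E}

lemma measurable_firstStep : Measurable (firstStep : E × (ℕ → Z) → E × Z) := by
  unfold firstStep; fun_prop

lemma measurable_chainShift (hs : Measurable s) : Measurable (chainShift s) := by
  have := measurable_firstStep (E := E) (Z := Z)
  unfold chainShift; fun_prop

/-- The first step and the later innovations are independent. -/
lemma measurePreserving_firstStep_tail :
    MeasurePreserving (fun ω : E × (ℕ → Z) => (firstStep ω, fun n => ω.2 (n + 1)))
      (chainLaw μ ν) ((μ.prod ν).prod (Measure.infinitePi fun _ : ℕ => ν)) :=
  (((measurePreserving_prodAssoc μ ν (Measure.infinitePi fun _ : ℕ => ν)).symm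
    MeasurableEquiv.prodAssoc).comp
    ((MeasurePreserving.id μ).prod (measurePreserving_headTail ν)) : _)

lemma measurePreserving_firstStep : MeasurePreserving (firstStep : E × (ℕ → Z) → E × Z)
    (chainLaw μ ν) (μ.prod ν) :=
  measurePreserving_fst.comp measurePreserving_firstStep_tail

lemma measurePreserving_chainShift (hs : MeasurePreserving s (μ.prod ν) μ) :
    MeasurePreserving (chainShift s) (chainLaw μ ν) (chainLaw μ ν) :=
  (hs.prod (MeasurePreserving.id (Measure.infinitePi fun _ : ℕ => ν))).comp
    measurePreserving_firstStep_tail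

/-- Markov property: given the first step, the future is a function of `s p` and of fresh
innovations, which Fubini integrates out. -/
lemma integral_firstStep_mul_chainShift (hs : MeasurePreserving s (μ.prod ν) μ)
    {φ : E × Z → ℝ} {ψ : E × (ℕ → Z) → ℝ} (hφm : Measurable φ) (hψm : Measurable ψ)
    (hφ : MemLp φ 2 (μ.prod ν)) (hψ : MemLp ψ 2 (chainLaw μ ν)) :
    ∫ ω, φ (firstStep ω) * ψ (chainShift s ω) ∂(chainLaw μ ν) =
      ∫ p, φ p * expectFrom ν ψ (s p) ∂(μ.prod ν) := by
  have hsm := hs.measurable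
  have hG : Measurable fun q : (E × Z) × (ℕ → Z) => φ q.1 * ψ (s q.1, q.2) := by fun_prop
  have h1 : ∫ ω, φ (firstStep ω) * ψ (chainShift s ω) ∂(chainLaw μ ν) =
      ∫ q, φ q.1 * ψ (s q.1, q.2) ∂((μ.prod ν).prod (Measure.infinitePi fun _ : ℕ => ν)) := by
    rw [← (measurePreserving_firstStep_tail (μ := μ) (ν := ν)).map_eq,
      integral_map (measurePreserving_firstStep_tail (μ := μ) (ν := ν)).aemeasurable
        hG.aestronglyMeasurable]
    rfl
  have h2 : MemLp (fun q : (E × Z) × (ℕ → Z) => ψ (s q.1, q.2)) 2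
      ((μ.prod ν).prod (Measure.infinitePi fun _ : ℕ => ν)) :=
    hψ.comp_measurePreserving (hs.prod (MeasurePreserving.id _))
  have h3 : MemLp (fun q : (E × Z) × (ℕ → Z) => φ q.1) 2
      ((μ.prod ν).prod (Measure.infinitePi fun _ : ℕ => ν)) :=
    hφ.comp_measurePreserving measurePreserving_fst
  rw [h1, integral_prod (fun q => φ q.1 * ψ (s q.1, q.2)) (h3.integrable_mul h2)]
  simp only [integral_const_mul]
  rfl

/-- Chapman-Kolmogorov. The equality is only almost sure because Fubini needs integrability of the
section at `x`. -/
lemma expectFrom_comp_chainShift (hs : MeasurePreserving s (μ.prod ν) μ)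
    {ψ : E × (ℕ → Z) → ℝ} (hψm : Measurable ψ) (hψ : Integrable ψ (chainLaw μ ν)) :
    expectFrom ν (ψ ∘ chainShift s) =ᵐ[μ] transOp ν s (expectFrom ν ψ) := by
  have hsm := hs.measurable
  have h2 : Integrable (fun q : (E × Z) × (ℕ → Z) => ψ (s q.1, q.2))
      ((μ.prod ν).prod (Measure.infinitePi fun _ : ℕ => ν)) :=
    (hs.prod (MeasurePreserving.id _)).integrable_comp_of_integrable hψ
  have h3 : Integrable (fun q : E × Z × (ℕ → Z) => ψ (s (q.1, q.2.1), q.2.2))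
      (μ.prod (ν.prod (Measure.infinitePi fun _ : ℕ => ν))) :=
    ((measurePreserving_prodAssoc μ ν (Measure.infinitePi fun _ : ℕ => ν)).symm
      MeasurableEquiv.prodAssoc).integrable_comp_of_integrable h2
  filter_upwards [h3.prod_right_ae] with x hx
  have hG : Measurable fun q : Z × (ℕ → Z) => ψ (s (x, q.1), q.2) := by fun_prop
  have h4 : expectFrom ν (ψ ∘ chainShift s) x =
      ∫ q, ψ (s (x, q.1), q.2) ∂(ν.prod (Measure.infinitePi fun _ : ℕ => ν)) := by
    rw [← (measurePreserving_headTail ν).map_eq,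
      integral_map (measurePreserving_headTail ν).aemeasurable hG.aestronglyMeasurable]
    rfl
  rw [h4, integral_prod _ hx]
  rfl

lemma measurable_expectFrom {ψ : E × (ℕ → Z) → ℝ} (hψm : Measurable ψ) :
    Measurable (expectFrom ν ψ) :=
  hψm.stronglyMeasurable.integral_prod_right'.measurable

/-- Integrating out an independent variable does not increase the second moment. -/
lemma memLp_integral_right {Y : Type*} [MeasurableSpace Y] {κ : Measure Y} [IsProbabilityMeasure κ]
    {f : E × Y → ℝ} (hf : Measurable f) (h2 : MemLp f 2 (μ.prod κ)) :
    MemLp (fun x => ∫ y, f (x, y) ∂κ) 2 μ ∧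
      ∫ x, (∫ y, f (x, y) ∂κ) ^ 2 ∂μ ≤ ∫ p, f p ^ 2 ∂(μ.prod κ) := by
  have hm : Measurable fun x => ∫ y, f (x, y) ∂κ :=
    hf.stronglyMeasurable.integral_prod_right'.measurable
  have hsq := h2.integrable_sq
  have hle : ∀ᵐ x ∂μ, (∫ y, f (x, y) ∂κ) ^ 2 ≤ ∫ y, f (x, y) ^ 2 ∂κ := by
    filter_upwards [hsq.prod_right_ae] with x hx
    have hx2 : MemLp (fun y => f (x, y)) 2 κ :=
      (memLp_two_iff_integrable_sq (hf.comp measurable_prodMk_left).aestronglyMeasurable).2 hx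
    have := sq_integral_mul_le hx2 (memLp_const (1 : ℝ))
    simpa using this
  have hint := hsq.integral_prod_left
  have hI : Integrable (fun x => (∫ y, f (x, y) ∂κ) ^ 2) μ := by
    refine hint.mono' (hm.pow_const 2).aestronglyMeasurable ?_
    filter_upwards [hle] with x hx
    rwa [Real.norm_of_nonneg (sq_nonneg _)]
  refine ⟨(memLp_two_iff_integrable_sq hm.aestronglyMeasurable).2 hI, ?_⟩
  rw [integral_prod _ hsq]
  exact integral_mono_ae hI hint hle

lemma memLp_transOp (hs : MeasurePreserving s (μ.prod ν) μ) {f : E → ℝ} (hfm : Measurable f)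
    (hf : MemLp f 2 μ) : MemLp (transOp ν s f) 2 μ :=
  (memLp_integral_right (f := f ∘ s) (hfm.comp hs.measurable)
    (hf.comp_measurePreserving hs)).1

lemma integral_transOp (hs : MeasurePreserving s (μ.prod ν) μ) {f : E → ℝ} (hfm : Measurable f)
    (hf : Integrable f μ) : ∫ x, transOp ν s f x ∂μ = ∫ x, f x ∂μ := by
  have h := integral_prod (μ := μ) (ν := ν) (f ∘ s) (hs.integrable_comp_of_integrable hf)
  conv_rhs => rw [← hs.map_eq, integral_map hs.aemeasurable hfm.aestronglyMeasurable]
  exact h.symm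

/-! ### Contraction of the transition operator. -/

/-- Under a uniform minorization `μ ≤ w P(x, ·)`, the transition operator contracts the centred
square-integrable functions by the factor `1 - w⁻¹`. -/
lemma integral_transOp_sq_le (hs : MeasurePreserving s (μ.prod ν) μ) {w : ℝ≥0} (hw : 1 < w)
    (hmin : ∀ x, μ ≤ w • ν.map (fun z => s (x, z))) {f : E → ℝ} (hfm : Measurable f)
    (hf : MemLp f 2 μ) (h0 : ∫ x, f x ∂μ = 0) :
    ∫ x, transOp ν s f x ^ 2 ∂μ ≤ (1 - (w : ℝ)⁻¹) ^ 2 * ∫ x, f x ^ 2 ∂μ := by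
  have hsm := hs.measurable
  have hw' : (1 : ℝ) < w := by exact_mod_cast hw
  set a : ℝ := (w : ℝ)⁻¹ with ha
  have ha0 : 0 < a := by positivity
  have ha1 : a < 1 := inv_lt_one_of_one_lt₀ hw'
  set V := ∫ x, f x ^ 2 ∂μ with hV
  have hfs : MemLp (f ∘ s) 2 (μ.prod ν) := hf.comp_measurePreserving hs
  have hsq := hfs.integrable_sq
  have hpt : ∀ᵐ x ∂μ, transOp ν s f x ^ 2 ≤ (1 - a) * (∫ z, f (s (x, z)) ^ 2 ∂ν - a * V) := by
    filter_upwards [hsq.prod_right_ae] with x hx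
    have hsx : Measurable fun z => s (x, z) := hsm.comp measurable_prodMk_left
    have hx2 : MemLp (fun z => f (s (x, z))) 2 ν :=
      (memLp_two_iff_integrable_sq (hfm.comp hsx).aestronglyMeasurable).2 hx
    have hx1 : Integrable (fun z => f (s (x, z))) ν := hx2.integrable one_le_two
    set m := transOp ν s f x with hm
    -- As `f` is centred under `μ`, this is the mean of `f` under the residual kernel `(P(x, ·) - a
    -- μ) / (1 - a)`. Comparing the integrals of `(f - t)²` under `μ` and `w P(x, ·)` gives Jensen's
    -- inequality for the residual kernel without constructing it.
    set t := m / (1 - a) with ht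
    have e1 : ∫ y, (f y - t) ^ 2 ∂μ = V + t ^ 2 := by
      have : ∀ y, (f y - t) ^ 2 = f y ^ 2 + (-2 * t) * f y + t ^ 2 := fun y => by ring
      simp only [this]
      rw [integral_add (hf.integrable_sq.fun_add ((hf.integrable one_le_two).const_mul _))
        (integrable_const _), integral_add hf.integrable_sq
        ((hf.integrable one_le_two).const_mul _), integral_const_mul, h0]
      simp [hV]
    have e2 : ∫ z, (f (s (x, z)) - t) ^ 2 ∂ν = ∫ z, f (s (x, z)) ^ 2 ∂ν - 2 * t * m + t ^ 2 := by
      have : ∀ z, (f (s (x, z)) - t) ^ 2 = f (s (x, z)) ^ 2 + (-2 * t) * f (s (x, z)) + t ^ 2 :=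
        fun y => by ring
      simp only [this]
      rw [integral_add (hx2.integrable_sq.fun_add (hx1.const_mul _)) (integrable_const _),
        integral_add hx2.integrable_sq (hx1.const_mul _), integral_const_mul]
      simp [hm, transOp]
      ring
    have hint : Integrable (fun z => (f (s (x, z)) - t) ^ 2) ν :=
      (hx2.sub (memLp_const t)).integrable_sq
    have hgm : Measurable fun y => (f y - t) ^ 2 := by fun_prop
    have hint' : Integrable (fun y => (f y - t) ^ 2) (ν.map fun z => s (x, z)) :=
      (integrable_map_measure hgm.aestronglyMeasurable hsx.aemeasurable).2 hint
    have e3 : ∫ y, (f y - t) ^ 2 ∂μ ≤ w * ∫ z, (f (s (x, z)) - t) ^ 2 ∂ν := by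
      have := integral_mono_measure (hmin x) (Eventually.of_forall fun y => sq_nonneg (f y - t))
        (hint'.smul_measure_nnreal)
      rwa [integral_smul_nnreal_measure, integral_map hsx.aemeasurable hgm.aestronglyMeasurable,
        NNReal.smul_def, smul_eq_mul] at this
    rw [e1, e2] at e3
    have e4 : a * (V + t ^ 2) ≤ ∫ z, f (s (x, z)) ^ 2 ∂ν - 2 * t * m + t ^ 2 := by
      rw [ha, inv_mul_le_iff₀ (by positivity)]; exact e3
    have hmt : m = (1 - a) * t := by rw [ht]; field_simp [(sub_pos.2 ha1).ne']
    rw [hmt] at e4 ⊢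
    nlinarith [mul_le_mul_of_nonneg_left e4 (sub_pos.2 ha1).le]
  have hI1 := (memLp_transOp hs hfm hf).integrable_sq
  have hI2 : Integrable (fun x => ∫ z, f (s (x, z)) ^ 2 ∂ν) μ := hsq.integral_prod_left
  have hVs : ∫ x, ∫ z, f (s (x, z)) ^ 2 ∂ν ∂μ = V :=
    integral_transOp hs (f := fun x => f x ^ 2) (by fun_prop) hf.integrable_sq
  calc ∫ x, transOp ν s f x ^ 2 ∂μ
      ≤ ∫ x, (1 - a) * (∫ z, f (s (x, z)) ^ 2 ∂ν - a * V) ∂μ :=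
        integral_mono_ae hI1 ((hI2.sub (integrable_const _)).const_mul _) hpt
    _ = (1 - a) ^ 2 * V := by
        rw [integral_const_mul, integral_sub hI2 (integrable_const _), hVs]
        simp
        ring

/-! ### Lag covariances and the asymptotic variance. -/

/-- The covariances of a centred functional of the steps of a stationary chain. -/
def lagCov (μ : Measure E) (ν : Measure Z) (s : E × Z → E) (h : E × Z → ℝ) (k : ℕ) : ℝ :=
  ∫ ω, h (firstStep ω) * h (firstStep ((chainShift s)^[k] ω)) ∂(chainLaw μ ν)

lemma lagCov_zero {h : E × Z → ℝ} (hm : Measurable h) :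
    lagCov μ ν s h 0 = ∫ p, h p ^ 2 ∂(μ.prod ν) := by
  rw [← (measurePreserving_firstStep (μ := μ) (ν := ν)).map_eq, integral_map
    measurePreserving_firstStep.aemeasurable (hm.pow_const 2).aestronglyMeasurable]
  simp [lagCov, sq]

/-- The conditional expectation of the functional `h` of the `k`-th step given the initial
state. -/
def lagMean (ν : Measure Z) (s : E × Z → E) (h : E × Z → ℝ) (k : ℕ) : E → ℝ :=
  expectFrom ν fun ω => h (firstStep ((chainShift s)^[k] ω))

lemma measurable_lag (hs : Measurable s) {h : E × Z → ℝ} (hm : Measurable h) (k : ℕ) :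
    Measurable fun ω => h (firstStep ((chainShift s)^[k] ω)) :=
  hm.comp (measurable_firstStep.comp ((measurable_chainShift hs).iterate k))

lemma measurable_lagMean (hs : Measurable s) {h : E × Z → ℝ} (hm : Measurable h) (k : ℕ) :
    Measurable (lagMean ν s h k) := measurable_expectFrom (measurable_lag hs hm k)

lemma measurePreserving_lag (hs : MeasurePreserving s (μ.prod ν) μ) (k : ℕ) :
    MeasurePreserving (fun ω => firstStep ((chainShift s)^[k] ω)) (chainLaw μ ν) (μ.prod ν) :=
  measurePreserving_firstStep.comp ((measurePreserving_chainShift hs).iterate k)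

lemma memLp_lag (hs : MeasurePreserving s (μ.prod ν) μ) {h : E × Z → ℝ}
    (h2 : MemLp h 2 (μ.prod ν)) (k : ℕ) :
    MemLp (fun ω => h (firstStep ((chainShift s)^[k] ω))) 2 (chainLaw μ ν) :=
  h2.comp_measurePreserving (measurePreserving_lag hs k)

lemma memLp_lagMean (hs : MeasurePreserving s (μ.prod ν) μ) {h : E × Z → ℝ} (hm : Measurable h)
    (h2 : MemLp h 2 (μ.prod ν)) (k : ℕ) : MemLp (lagMean ν s h k) 2 μ :=
  (memLp_integral_right (measurable_lag hs.measurable hm k) (memLp_lag hs h2 k)).1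

lemma lagMean_succ (hs : MeasurePreserving s (μ.prod ν) μ) {h : E × Z → ℝ} (hm : Measurable h)
    (h2 : MemLp h 2 (μ.prod ν)) (k : ℕ) :
    lagMean ν s h (k + 1) =ᵐ[μ] transOp ν s (lagMean ν s h k) :=
  expectFrom_comp_chainShift hs (measurable_lag hs.measurable hm k)
    ((memLp_lag hs h2 k).integrable one_le_two)

lemma integral_lagMean (hs : MeasurePreserving s (μ.prod ν) μ) {h : E × Z → ℝ} (hm : Measurable h)
    (h2 : MemLp h 2 (μ.prod ν)) (k : ℕ) : ∫ x, lagMean ν s h k x ∂μ = ∫ p, h p ∂(μ.prod ν) := by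
  rw [← (measurePreserving_lag (μ := μ) (ν := ν) hs k).map_eq,
    integral_map (measurePreserving_lag hs k).aemeasurable hm.aestronglyMeasurable,
    integral_prod _ ((memLp_lag hs h2 k).integrable one_le_two)]
  rfl

lemma lagCov_succ (hs : MeasurePreserving s (μ.prod ν) μ) {h : E × Z → ℝ} (hm : Measurable h)
    (h2 : MemLp h 2 (μ.prod ν)) (k : ℕ) :
    lagCov μ ν s h (k + 1) = ∫ p, h p * lagMean ν s h k (s p) ∂(μ.prod ν) :=
  integral_firstStep_mul_chainShift hs hm (measurable_lag hs.measurable hm k) h2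
    (memLp_lag hs h2 k)

/-- Each further lag applies the transition operator once and keeps the mean zero, so the
contraction iterates; lag zero is conditional Jensen. -/
lemma integral_lagMean_sq_le (hs : MeasurePreserving s (μ.prod ν) μ) {w : ℝ≥0} (hw : 1 < w)
    (hmin : ∀ x, μ ≤ w • ν.map (fun z => s (x, z))) {h : E × Z → ℝ} (hm : Measurable h)
    (h2 : MemLp h 2 (μ.prod ν)) (h0 : ∫ p, h p ∂(μ.prod ν) = 0) (k : ℕ) :
    ∫ x, lagMean ν s h k x ^ 2 ∂μ ≤ ((1 - (w : ℝ)⁻¹) ^ k) ^ 2 * ∫ p, h p ^ 2 ∂(μ.prod ν) := by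
  induction k with
  | zero =>
    have := (memLp_integral_right (measurable_lag hs.measurable hm 0) (memLp_lag hs h2 0)).2
    have e := lagCov_zero (μ := μ) (ν := ν) (s := s) hm
    simp only [lagCov, ← sq, Function.iterate_zero, id] at e this
    rw [pow_zero, one_pow, one_mul, ← e]
    exact this
  | succ k ih =>
    have e : ∫ x, lagMean ν s h (k + 1) x ^ 2 ∂μ =
        ∫ x, transOp ν s (lagMean ν s h k) x ^ 2 ∂μ :=
      integral_congr_ae ((lagMean_succ hs hm h2 k).mono fun x hx => by simp only [hx])
    rw [e]
    refine (integral_transOp_sq_le hs hw hmin (measurable_lagMean hs.measurable hm k)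
      (memLp_lagMean hs hm h2 k) ((integral_lagMean hs hm h2 k).trans h0)).trans ?_
    rw [pow_succ _ k, mul_pow, mul_comm (_ ^ 2) ((1 - (w : ℝ)⁻¹) ^ 2), mul_assoc]
    gcongr

/-- Lag `k + 1` gains only `k` contractions: `h` may depend on the first innovation, so conditioning
starts at the state after the first step. -/
lemma abs_lagCov_succ_le (hs : MeasurePreserving s (μ.prod ν) μ) {w : ℝ≥0} (hw : 1 < w)
    (hmin : ∀ x, μ ≤ w • ν.map (fun z => s (x, z))) {h : E × Z → ℝ} (hm : Measurable h)
    (h2 : MemLp h 2 (μ.prod ν)) (h0 : ∫ p, h p ∂(μ.prod ν) = 0) (k : ℕ) :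
    |lagCov μ ν s h (k + 1)| ≤ (1 - (w : ℝ)⁻¹) ^ k * ∫ p, h p ^ 2 ∂(μ.prod ν) := by
  have hw' : (1 : ℝ) < w := by exact_mod_cast hw
  have ha1 : (w : ℝ)⁻¹ < 1 := inv_lt_one_of_one_lt₀ hw'
  have hV : 0 ≤ ∫ p, h p ^ 2 ∂(μ.prod ν) := integral_nonneg fun _ => sq_nonneg _
  have hLm := measurable_lagMean (ν := ν) hs.measurable hm k
  refine abs_le_of_sq_le_sq ?_ (mul_nonneg (pow_nonneg (by linarith) _) hV)
  rw [lagCov_succ hs hm h2]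
  refine (sq_integral_mul_le h2 ((memLp_lagMean hs hm h2 k).comp_measurePreserving hs)).trans ?_
  have e : ∫ p, lagMean ν s h k (s p) ^ 2 ∂(μ.prod ν) = ∫ x, lagMean ν s h k x ^ 2 ∂μ := by
    conv_rhs => rw [← hs.map_eq, integral_map hs.aemeasurable
      (hLm.pow_const 2).aestronglyMeasurable]
  simp only [Function.comp_apply, e]
  refine (mul_le_mul_of_nonneg_left (integral_lagMean_sq_le hs hw hmin hm h2 h0 k) hV).trans ?_
  apply le_of_eq; ring

/-- The second moment of the partial sums grows by the lag covariances. -/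
lemma integral_sq_sum_succ (hs : MeasurePreserving s (μ.prod ν) μ) {h : E × Z → ℝ}
    (hm : Measurable h) (h2 : MemLp h 2 (μ.prod ν)) (n : ℕ) :
    ∫ ω, (∑ i ∈ Finset.range (n + 1), h (firstStep ((chainShift s)^[i] ω))) ^ 2 ∂(chainLaw μ ν) =
      (∫ ω, (∑ i ∈ Finset.range n, h (firstStep ((chainShift s)^[i] ω))) ^ 2 ∂(chainLaw μ ν)) +
        (lagCov μ ν s h 0 + 2 * ∑ k ∈ Finset.range n, lagCov μ ν s h (k + 1)) := by
  set H : ℕ → E × (ℕ → Z) → ℝ := fun i ω => h (firstStep ((chainShift s)^[i] ω)) with hH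
  have hH2 (i) : MemLp (H i) 2 (chainLaw μ ν) := memLp_lag hs h2 i
  have hS : MemLp (fun ω => ∑ i ∈ Finset.range n, H i ω) 2 (chainLaw μ ν) :=
    memLp_finsetSum _ fun i _ => hH2 i
  have hcov (i j : ℕ) : ∫ ω, H i ω * H (i + j) ω ∂(chainLaw μ ν) = lagCov μ ν s h j := by
    have hT := (measurePreserving_chainShift (μ := μ) (ν := ν) hs).iterate i
    have : lagCov μ ν s h j = ∫ ω, H 0 ω * H j ω
        ∂(Measure.map (chainShift s)^[i] (chainLaw μ ν)) := by
      rw [hT.map_eq]; rfl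
    rw [this, integral_map hT.aemeasurable ((measurable_lag hs.measurable hm 0).fun_mul
      (measurable_lag hs.measurable hm j)).aestronglyMeasurable]
    simp only [hH, ← Function.iterate_add_apply, zero_add, add_comm j i]
  have e (ω) : (∑ i ∈ Finset.range (n + 1), H i ω) ^ 2 =
      (∑ i ∈ Finset.range n, H i ω) ^ 2 +
        (H n ω * H n ω + 2 * ∑ i ∈ Finset.range n, H i ω * H n ω) := by
    rw [Finset.sum_range_succ, ← Finset.sum_mul]; ring
  have hint (i) : Integrable (fun ω => H i ω * H n ω) (chainLaw μ ν) :=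
    (hH2 i).integrable_mul (hH2 n)
  refine (integral_congr_ae (Eventually.of_forall e)).trans ?_
  rw [integral_add hS.integrable_sq ((hint n).fun_add
    ((integrable_finsetSum _ fun i _ => hint i).const_mul 2)), integral_add (hint n)
    ((integrable_finsetSum _ fun i _ => hint i).const_mul 2), integral_const_mul,
    integral_finsetSum _ fun i _ => hint i]
  congr 2
  · exact hcov n 0
  -- The pair `(i, n)` has lag `n - i`; reversing the sum makes the lags run over `1, ..., n`.
  · rw [← Finset.sum_range_reflect]
    congr 1
    refine Finset.sum_congr rfl fun i hi => ?_
    rw [← hcov (n - 1 - i) (i + 1)]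
    have : n - 1 - i + (i + 1) = n := by have := Finset.mem_range.1 hi; omega
    rw [this]

/-- The asymptotic variance of a centred functional of the steps of a stationary, uniformly
minorized chain. -/
theorem exists_tendsto_sq_sum (hs : MeasurePreserving s (μ.prod ν) μ) {w : ℝ≥0} (hw : 1 < w)
    (hmin : ∀ x, μ ≤ w • ν.map (fun z => s (x, z))) {h : E × Z → ℝ} (hm : Measurable h)
    (h2 : MemLp h 2 (μ.prod ν)) (h0 : ∫ p, h p ∂(μ.prod ν) = 0) :
    ∃ L : ℝ, Tendsto (fun n : ℕ => (n : ℝ)⁻¹ *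
        ∫ ω, (∑ i ∈ Finset.range n, h (firstStep ((chainShift s)^[i] ω))) ^ 2 ∂(chainLaw μ ν))
        atTop (𝓝 L) ∧
      L ≤ (1 + 2 * w) * ∫ p, h p ^ 2 ∂(μ.prod ν) ∧
      ((∀ k, 0 ≤ lagCov μ ν s h (k + 1)) → ∫ p, h p ^ 2 ∂(μ.prod ν) ≤ L) := by
  have hw' : (1 : ℝ) < w := by exact_mod_cast hw
  have ha1 : (w : ℝ)⁻¹ < 1 := inv_lt_one_of_one_lt₀ hw'
  have ha0 : 0 < (w : ℝ)⁻¹ := by positivity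
  set V := ∫ p, h p ^ 2 ∂(μ.prod ν) with hV
  -- The geometric series with ratio `1 - 1/w` sums to `w`; doubled, with lag zero added, it gives
  -- the constant `1 + 2w`.
  have hgeo : HasSum (fun k : ℕ => (1 - (w : ℝ)⁻¹) ^ k * V) (w * V) := by
    have := (hasSum_geometric_of_lt_one (r := 1 - (w : ℝ)⁻¹) (by linarith)
      (by linarith)).mul_right V
    simpa using this
  have hle (k) := abs_lagCov_succ_le hs hw hmin hm h2 h0 k
  have hsum : Summable fun k => lagCov μ ν s h (k + 1) :=
    Summable.of_norm_bounded hgeo.summable hle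
  -- These are the increments of the second moment of the partial sums; the Cesàro mean of a
  -- convergent sequence has the same limit.
  have hinc : Tendsto (fun n => lagCov μ ν s h 0 +
      2 * ∑ k ∈ Finset.range n, lagCov μ ν s h (k + 1)) atTop
      (𝓝 (lagCov μ ν s h 0 + 2 * ∑' k, lagCov μ ν s h (k + 1))) :=
    (hsum.hasSum.tendsto_sum_nat.const_mul 2).const_add _
  refine ⟨_, hinc.cesaro.congr fun n => ?_, ?_, fun hpos => ?_⟩
  · congr 1
    induction n with
    | zero => simp
    | succ n ih => rw [Finset.sum_range_succ, ih, integral_sq_sum_succ hs hm h2]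
  · have : ∑' k, lagCov μ ν s h (k + 1) ≤ w * V :=
      hasSum_le (fun k => (le_abs_self _).trans (hle k)) hsum.hasSum hgeo
    rw [lagCov_zero hm]
    linarith
  · rw [lagCov_zero hm]
    have : 0 ≤ ∑' k, lagCov μ ν s h (k + 1) := tsum_nonneg hpos
    linarith

/-- For a reversible chain with positive transition operator, the autocovariances of a function of
the state are nonnegative. -/
lemma lagCov_succ_nonneg (hs : MeasurePreserving s (μ.prod ν) μ)
    (hsymm : ∀ f g : E → ℝ, Measurable f → Measurable g → MemLp f 2 μ → MemLp g 2 μ →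
      ∫ x, f x * transOp ν s g x ∂μ = ∫ x, g x * transOp ν s f x ∂μ)
    (hpos : ∀ f : E → ℝ, Measurable f → MemLp f 2 μ → 0 ≤ ∫ x, f x * transOp ν s f x ∂μ)
    {f : E → ℝ} (hm : Measurable f) (h2 : MemLp f 2 μ) (k : ℕ) :
    0 ≤ lagCov μ ν s (fun p => f p.1) (k + 1) := by
  have hm' : Measurable fun p : E × Z => f p.1 := by fun_prop
  have h2' : MemLp (fun p : E × Z => f p.1) 2 (μ.prod ν) :=
    h2.comp_measurePreserving measurePreserving_fst
  set G := lagMean ν s fun p : E × Z => f p.1 with hG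
  have hGm (j) : Measurable (G j) := measurable_lagMean hs.measurable hm' j
  have hG2 (j) : MemLp (G j) 2 μ := memLp_lagMean hs hm' h2' j
  have hG0 : G 0 = f := by
    ext x
    simp [hG, lagMean, expectFrom, firstStep]
  have hGs (j) : ∀ᵐ x ∂μ, G (j + 1) x = transOp ν s (G j) x := lagMean_succ hs hm' h2' j
  have hcov : lagCov μ ν s (fun p => f p.1) (k + 1) = ∫ x, G 0 x * G (k + 1) x ∂μ := by
    rw [lagCov_succ hs hm' h2', integral_prod (fun p : E × Z => f p.1 * G k (s p))
      (h2'.integrable_mul ((hG2 k).comp_measurePreserving hs))]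
    simp only [integral_const_mul, hG0]
    refine integral_congr_ae ((hGs k).mono fun x hx => ?_)
    simp only [hx]
    rfl
  -- Self-adjointness moves one application of the operator from one factor to the other.
  have hshift (i j) : ∫ x, G i x * G (j + 1) x ∂μ = ∫ x, G (i + 1) x * G j x ∂μ := by
    calc ∫ x, G i x * G (j + 1) x ∂μ = ∫ x, G i x * transOp ν s (G j) x ∂μ :=
          integral_congr_ae ((hGs j).mono fun x hx => by simp only [hx])
      _ = ∫ x, G j x * transOp ν s (G i) x ∂μ := hsymm _ _ (hGm i) (hGm j) (hG2 i) (hG2 j)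
      _ = ∫ x, G (i + 1) x * G j x ∂μ :=
          integral_congr_ae ((hGs i).mono fun x hx => by simp only [hx, mul_comm])
  have hmove (i j) : ∫ x, G 0 x * G (i + j) x ∂μ = ∫ x, G i x * G j x ∂μ := by
    induction i generalizing j with
    | zero => simp
    | succ i ih => rw [← hshift, ← ih]; congr! 4; omega
  rw [hcov]
  -- An even lag `2m` gives `‖Pᵐ f‖²`; an odd lag `2m + 1` gives `⟨Pᵐ f, P Pᵐ f⟩`, nonnegative by
  -- positivity of `P`.
  obtain ⟨m, hm | hm⟩ := Nat.even_or_odd' (k + 1)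
  · rw [hm, two_mul, hmove]
    exact integral_nonneg fun x => mul_self_nonneg _
  · rw [hm, two_mul, add_assoc, hmove]
    refine (hpos _ (hGm m) (hG2 m)).trans_eq ?_
    exact integral_congr_ae ((hGs m).mono fun x hx => by simp only [hx])

end RandomMapping

/-! ### Positive semidefiniteness of the minimum kernel. -/

section PositiveKernel

variable {E : Type*} [MeasurableSpace E]

/-- The kernel `min (ρ x) (ρ y)` is positive semidefinite. -/
lemma integral_min_mul_nonneg {m : Measure E} [SFinite m] {ρ f : E → ℝ} (hρ : Measurable ρ)
    (hρ0 : ∀ x, 0 ≤ ρ x) (hf : Measurable f)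
    (hint : Integrable (fun p : E × E => min (ρ p.1) (ρ p.2) * (f p.1 * f p.2)) (m.prod m)) :
    0 ≤ ∫ p, min (ρ p.1) (ρ p.2) * (f p.1 * f p.2) ∂(m.prod m) := by
  set τ : Measure ℝ := volume.restrict (Set.Ioi 0) with hτ
  -- Layer cake: `min (ρ x) (ρ y)` is the integral over `t > 0` of `1{t < ρ x} 1{t < ρ y}`. After
  -- Fubini, the integrand in `t` is the square of `∫ f 1{t < ρ}`.
  set g : E → ℝ → ℝ := fun x t => if t < ρ x then f x else 0 with hg
  have hΦm : Measurable fun q : (E × E) × ℝ => g q.1.1 q.2 * g q.1.2 q.2 := by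
    refine Measurable.mul ?_ ?_ <;>
    exact Measurable.ite (measurableSet_lt (by fun_prop) (by fun_prop)) (by fun_prop)
      measurable_const
  have hsec (p : E × E) : (fun t => g p.1 t * g p.2 t) =
      (Set.Iio (min (ρ p.1) (ρ p.2))).indicator fun _ => f p.1 * f p.2 := by
    ext t
    simp only [hg, Set.indicator, Set.mem_Iio, lt_min_iff]
    split_ifs <;> simp_all
  have hvol (p : E × E) : τ (Set.Iio (min (ρ p.1) (ρ p.2))) =
      ENNReal.ofReal (min (ρ p.1) (ρ p.2)) := by
    rw [hτ, Measure.restrict_apply measurableSet_Iio, Set.inter_comm, Set.Ioi_inter_Iio,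
      Real.volume_Ioo, sub_zero]
  have hmin0 (p : E × E) : 0 ≤ min (ρ p.1) (ρ p.2) := le_min (hρ0 _) (hρ0 _)
  have hI (p : E × E) : ∫ t, g p.1 t * g p.2 t ∂τ = min (ρ p.1) (ρ p.2) * (f p.1 * f p.2) := by
    rw [hsec, integral_indicator_const _ measurableSet_Iio, measureReal_def, hvol,
      ENNReal.toReal_ofReal (hmin0 p), smul_eq_mul]
  have hN (p : E × E) : ∫ t, ‖g p.1 t * g p.2 t‖ ∂τ =
      ‖min (ρ p.1) (ρ p.2) * (f p.1 * f p.2)‖ := by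
    have : (fun t => ‖g p.1 t * g p.2 t‖) =
        (Set.Iio (min (ρ p.1) (ρ p.2))).indicator fun _ => ‖f p.1 * f p.2‖ := by
      ext t
      rw [congrFun (hsec p) t, norm_indicator_eq_indicator_norm]
    rw [this, integral_indicator_const _ measurableSet_Iio, measureReal_def, hvol,
      ENNReal.toReal_ofReal (hmin0 p), smul_eq_mul, norm_mul (min _ _),
      Real.norm_of_nonneg (hmin0 p)]
  have hΦ : Integrable (fun q : (E × E) × ℝ => g q.1.1 q.2 * g q.1.2 q.2) ((m.prod m).prod τ) := by
    rw [integrable_prod_iff hΦm.aestronglyMeasurable]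
    refine ⟨Eventually.of_forall fun p => ?_, ?_⟩
    · simp only
      rw [hsec, integrable_indicator_iff measurableSet_Iio]
      refine integrableOn_const ?_
      rw [hvol]
      exact ENNReal.ofReal_ne_top
    · simp only [hN]
      exact hint.norm
  have h1 := integral_prod _ hΦ
  rw [integral_prod_symm _ hΦ] at h1
  simp only [hI] at h1
  rw [← h1]
  refine integral_nonneg fun t => ?_
  rw [integral_prod_mul (μ := m) (ν := m) (fun x => g x t) (fun x => g x t)]
  exact mul_self_nonneg _

end PositiveKernel

/-! ### Pointwise properties of the acceptance probability. -/

section Accept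

variable {S : Type*} {π q : S → ℝ}

lemma accept_nonneg (hπ : ∀ x, 0 ≤ π x) (hq : ∀ x, 0 ≤ q x) (x y : S) : 0 ≤ accept π q x y := by
  unfold accept
  split_ifs with h
  · exact le_min zero_le_one (div_nonneg (mul_nonneg (hπ y) (hq x)) h.le)
  · exact zero_le_one

lemma accept_le_one (x y : S) : accept π q x y ≤ 1 := by
  unfold accept
  split_ifs with h
  · exact min_le_left _ _
  · exact le_rfl

lemma mul_accept (hπ : ∀ x, 0 ≤ π x) (hq : ∀ x, 0 ≤ q x) (x y : S) :
    π x * q y * accept π q x y = min (π x * q y) (π y * q x) := by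
  unfold accept
  split_ifs with h
  · rw [mul_min_of_nonneg _ _ h.le, mul_one, mul_div_cancel₀ _ h.ne']
  · have h0 : π x * q y = 0 := le_antisymm (not_lt.1 h) (mul_nonneg (hπ x) (hq y))
    rw [h0, zero_mul, min_eq_left (mul_nonneg (hπ y) (hq x))]

/-- If the minimum is not `1`, then `α(x, y) q y = π y q x / π x`, and `q x / π x ≥ 1/w`; otherwise
the bound is `π y ≤ w q y`. -/
lemma le_mul_accept_mul (hπ : ∀ x, 0 ≤ π x) (hq : ∀ x, 0 ≤ q x) {w : ℝ}
    (hw : ∀ x, π x ≤ w * q x) (x y : S) : π y ≤ w * (accept π q x y * q y) := by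
  unfold accept
  split_ifs with h
  · have hx : 0 < π x := (hπ x).lt_of_ne fun h0 => by simp [← h0] at h
    have hy : 0 < q y := (hq y).lt_of_ne fun h0 => by simp [← h0] at h
    rcases min_choice 1 (π y * q x / (π x * q y)) with e | e
    · rw [e, one_mul]; exact hw y
    · rw [e]
      have : w * (π y * q x / (π x * q y) * q y) = π y * (w * q x) / π x := by field_simp
      rw [this, le_div_iff₀ hx]
      exact mul_le_mul_of_nonneg_left (hw x) (hπ y)
  · rw [one_mul]; exact hw y

end Accept

/-! ### Minorization, reversibility and positivity of the Metropolis kernel. -/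

section Kernel

variable {S : Type*} [MeasureSpace S] {π q : S → ℝ}

lemma IsProbDensity.isProbabilityMeasure {p : S → ℝ} (hp : IsProbDensity p) :
    IsProbabilityMeasure (law p) := by
  refine ⟨?_⟩
  rw [law, withDensity_apply _ MeasurableSet.univ, Measure.restrict_univ, hp.lintegral_eq_one]

/-- One step of the algorithm, as a function of the state, the proposal and the acceptance
variable. -/
def step (π q : S → ℝ) (p : S × (S × unitInterval)) : S :=
  if (p.2.2 : ℝ) < accept π q p.1 p.2.1 then p.2.1 else p.1

lemma measurable_step (hπ : Measurable π) (hq : Measurable q) : Measurable (step π q) := by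
  have h : Measurable fun p : S × (S × unitInterval) => accept π q p.1 p.2.1 :=
    (measurable_accept hπ hq).comp (measurable_fst.prodMk (measurable_fst.comp measurable_snd))
  exact Measurable.ite (measurableSet_lt (by fun_prop) h) (by fun_prop) (by fun_prop)

lemma lintegral_unitInterval_ite {a : ℝ} (h0 : 0 ≤ a) (h1 : a ≤ 1) (A B : ℝ≥0∞) :
    ∫⁻ u : unitInterval, (if (u : ℝ) < a then A else B) =
      ENNReal.ofReal a * A + ENNReal.ofReal (1 - a) * B := by
  have hset : {u : unitInterval | (u : ℝ) < a} = Set.Iio ⟨a, h0, h1⟩ := by ext u; rfl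
  have e : (fun u : unitInterval => if (u : ℝ) < a then A else B) = fun u =>
      (Set.Iio (⟨a, h0, h1⟩ : unitInterval)).indicator (fun _ => A) u +
        (Set.Ici (⟨a, h0, h1⟩ : unitInterval)).indicator (fun _ => B) u := by
    ext u
    by_cases hu : (u : ℝ) < a
    · have hI : u ∈ Set.Iio (⟨a, h0, h1⟩ : unitInterval) := hu
      have h2 : u ∉ Set.Ici (⟨a, h0, h1⟩ : unitInterval) :=
        fun h => absurd hu (not_lt.2 (Set.mem_Ici.1 h : a ≤ (u : ℝ)))
      simp [hu, hI, h2]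
    · have h2 : u ∈ Set.Ici (⟨a, h0, h1⟩ : unitInterval) := not_lt.1 hu
      have hI : u ∉ Set.Iio (⟨a, h0, h1⟩ : unitInterval) := hu
      simp [hu, hI, h2]
  rw [e, lintegral_add_left (measurable_const.indicator measurableSet_Iio),
    lintegral_indicator_const measurableSet_Iio, lintegral_indicator_const measurableSet_Ici,
    unitInterval.volume_Iio, unitInterval.volume_Ici, mul_comm A, mul_comm B]

instance instSFiniteLaw [SFinite (volume : Measure S)] (p : S → ℝ) : SFinite (law p) := by
  unfold law; infer_instance

/-- The law of a proposal and an acceptance variable. -/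
abbrev innovationLaw (q : S → ℝ) : Measure (S × unitInterval) := (law q).prod volume

lemma lintegral_innovationLaw (hπ : IsProbDensity π) (hq : IsProbDensity q) (x : S)
    {G : S → ℝ≥0∞} (hG : Measurable G) :
    ∫⁻ z, G (step π q (x, z)) ∂(innovationLaw q) =
      ∫⁻ y, (ENNReal.ofReal (accept π q x y) * G y +
        ENNReal.ofReal (1 - accept π q x y) * G x) ∂(law q) := by
  have hm : Measurable fun z => G (step π q (x, z)) :=
    hG.comp ((measurable_step hπ.measurable hq.measurable).comp measurable_prodMk_left)
  rw [lintegral_prod _ hm.aemeasurable]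
  refine lintegral_congr fun y => ?_
  rw [← lintegral_unitInterval_ite (accept_nonneg hπ.nonneg hq.nonneg x y) (accept_le_one x y)]
  refine lintegral_congr fun u => ?_
  simp only [step]
  split_ifs <;> rfl

/-- Accepted moves alone suffice; the rejected mass is discarded as nonnegative. -/
lemma law_le_smul_map_step (hπ : IsProbDensity π) (hq : IsProbDensity q) {w : ℝ≥0}
    (hw : ∀ x, π x ≤ w * q x) (x : S) :
    law π ≤ w • (innovationLaw q).map fun z => step π q (x, z) := by
  have hs : Measurable fun z => step π q (x, z) :=
    (measurable_step hπ.measurable hq.measurable).comp measurable_prodMk_left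
  refine Measure.le_iff.2 fun A hA => ?_
  have hα : Measurable fun y => ENNReal.ofReal (accept π q x y) :=
    ((measurable_accept hπ.measurable hq.measurable).comp measurable_prodMk_left).ennreal_ofReal
  have hind : Measurable (A.indicator (1 : S → ℝ≥0∞)) := measurable_one.indicator hA
  have e1 : (innovationLaw q).map (fun z => step π q (x, z)) A =
      ∫⁻ z, A.indicator 1 (step π q (x, z)) ∂(innovationLaw q) := by
    rw [← lintegral_indicator_one hA, lintegral_map hind hs]
  calc law π A = ∫⁻ y, A.indicator (fun y => ENNReal.ofReal (π y)) y := by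
        rw [law, withDensity_apply _ hA, lintegral_indicator hA]
    _ ≤ ∫⁻ y, w * (ENNReal.ofReal (q y) *
          (ENNReal.ofReal (accept π q x y) * A.indicator 1 y)) := by
        refine lintegral_mono fun y => ?_
        by_cases hy : y ∈ A
        · simp only [Set.indicator_of_mem hy, Pi.one_apply, mul_one]
          rw [← ENNReal.ofReal_mul (hq.nonneg y), ← ENNReal.ofReal_coe_nnreal,
            ← ENNReal.ofReal_mul w.coe_nonneg, mul_comm (q y)]
          exact ENNReal.ofReal_le_ofReal (le_mul_accept_mul hπ.nonneg hq.nonneg hw x y)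
        · simp [hy]
    _ = w * ∫⁻ y, ENNReal.ofReal (accept π q x y) * A.indicator 1 y ∂(law q) := by
        rw [lintegral_const_mul' _ _ ENNReal.coe_ne_top, law,
          lintegral_withDensity_eq_lintegral_mul _ hq.measurable.ennreal_ofReal (by fun_prop)]
        rfl
    _ ≤ w * ∫⁻ y, (ENNReal.ofReal (accept π q x y) * A.indicator 1 y +
          ENNReal.ofReal (1 - accept π q x y) * A.indicator 1 x) ∂(law q) := by
        gcongr
        exact le_self_add
    _ = (w • (innovationLaw q).map fun z => step π q (x, z)) A := by
        rw [Measure.smul_apply, e1, lintegral_innovationLaw hπ hq x hind, ENNReal.smul_def,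
          smul_eq_mul]

/-- The part of the joint law of two consecutive states coming from accepted proposals. -/
def acceptedLaw (π q : S → ℝ) : Measure (S × S) :=
  ((law π).prod (law q)).withDensity fun p => ENNReal.ofReal (accept π q p.1 p.2)

/-- The part of the joint law of two consecutive states coming from rejected proposals. -/
def rejectedLaw (π q : S → ℝ) : Measure (S × S) :=
  (((law π).prod (law q)).withDensity fun p => ENNReal.ofReal (1 - accept π q p.1 p.2)).map
    fun p => (p.1, p.1)

variable [SFinite (volume : Measure S)]

lemma map_step_eq (hπ : IsProbDensity π) (hq : IsProbDensity q) :
    ((law π).prod (innovationLaw q)).map (fun p => (p.1, step π q p)) =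
      acceptedLaw π q + rejectedLaw π q := by
  have hs := measurable_step hπ.measurable hq.measurable
  have hα := measurable_accept hπ.measurable hq.measurable
  have hα1 : Measurable fun p : S × S => ENNReal.ofReal (accept π q p.1 p.2) := hα.ennreal_ofReal
  have hα2 : Measurable fun p : S × S => ENNReal.ofReal (1 - accept π q p.1 p.2) :=
    (measurable_const.sub hα).ennreal_ofReal
  refine Measure.ext_of_lintegral _ fun G hG => ?_
  have hG1 : Measurable fun p : S × S => G (p.1, p.1) := by fun_prop
  rw [lintegral_map hG (by fun_prop), lintegral_prod _ (by fun_prop), lintegral_add_measure,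
    acceptedLaw, rejectedLaw, lintegral_map hG (by fun_prop),
    lintegral_withDensity_eq_lintegral_mul _ hα1 hG,
    lintegral_withDensity_eq_lintegral_mul _ hα2 hG1, ← lintegral_add_left (hα1.mul hG),
    lintegral_prod _ (((hα1.mul hG).fun_add (hα2.mul hG1)).aemeasurable)]
  refine lintegral_congr fun x => ?_
  have key (a : S) : ∫⁻ z, G (a, step π q (x, z)) ∂(innovationLaw q) =
      ∫⁻ y, (ENNReal.ofReal (accept π q x y) * G (a, y) +
        ENNReal.ofReal (1 - accept π q x y) * G (a, x)) ∂(law q) :=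
    lintegral_innovationLaw hπ hq x (G := fun y => G (a, y)) (by fun_prop)
  exact key x

/-- This form exhibits the symmetry in the two states, which is detailed balance for accepted moves.
-/
lemma acceptedLaw_eq_withDensity_volume (hπ : IsProbDensity π) (hq : IsProbDensity q) :
    acceptedLaw π q = (volume.prod volume).withDensity fun p : S × S =>
      ENNReal.ofReal (min (π p.1 * q p.2) (π p.2 * q p.1)) := by
  have hα := measurable_accept hπ.measurable hq.measurable
  have hα1 : Measurable fun p : S × S => ENNReal.ofReal (accept π q p.1 p.2) := hα.ennreal_ofReal
  have hπm := hπ.measurable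
  have hqm := hq.measurable
  rw [acceptedLaw, law, law, prod_withDensity hπm.ennreal_ofReal hqm.ennreal_ofReal,
    ← withDensity_mul _ (by fun_prop) hα1]
  congr 1 with p
  simp only [Pi.mul_apply]
  rw [← ENNReal.ofReal_mul (hπ.nonneg _), ← ENNReal.ofReal_mul (mul_nonneg (hπ.nonneg _)
    (hq.nonneg _)), mul_accept hπ.nonneg hq.nonneg]

/-- This form exhibits the positive semidefinite minimum kernel. Where `π` vanishes at either point,
both densities are zero. -/
lemma acceptedLaw_eq_withDensity_law (hπ : IsProbDensity π) (hq : IsProbDensity q) :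
    acceptedLaw π q = ((law π).prod (law π)).withDensity fun p : S × S =>
      ENNReal.ofReal (min (q p.1 / π p.1) (q p.2 / π p.2)) := by
  have hπm := hπ.measurable
  have hqm := hq.measurable
  rw [acceptedLaw_eq_withDensity_volume hπ hq, law,
    prod_withDensity hπm.ennreal_ofReal hπm.ennreal_ofReal,
    ← withDensity_mul _ (by fun_prop) (by fun_prop)]
  congr 1 with p
  simp only [Pi.mul_apply]
  rw [← ENNReal.ofReal_mul (hπ.nonneg _), ← ENNReal.ofReal_mul (mul_nonneg (hπ.nonneg _)
    (hπ.nonneg _)), mul_min_of_nonneg _ _ (mul_nonneg (hπ.nonneg _) (hπ.nonneg _))]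
  rcases (hπ.nonneg p.1).eq_or_lt with h1 | h1
  · simp [← h1, mul_nonneg (hπ.nonneg p.2) (hq.nonneg p.1)]
  rcases (hπ.nonneg p.2).eq_or_lt with h2 | h2
  · simp [← h2, mul_nonneg (hπ.nonneg p.1) (hq.nonneg p.2)]
  rw [min_comm]
  congr 2 <;> field_simp

/-- Detailed balance: the joint law of two consecutive states is symmetric. -/
lemma map_swap_map_step (hπ : IsProbDensity π) (hq : IsProbDensity q) :
    (((law π).prod (innovationLaw q)).map fun p => (p.1, step π q p)).map Prod.swap =
      ((law π).prod (innovationLaw q)).map fun p => (p.1, step π q p) := by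
  have hπm := hπ.measurable
  have hqm := hq.measurable
  rw [map_step_eq hπ hq, Measure.map_add _ _ measurable_swap]
  congr 1
  · refine Measure.ext_of_lintegral _ fun G hG => ?_
    have hk : Measurable fun p : S × S =>
      ENNReal.ofReal (min (π p.1 * q p.2) (π p.2 * q p.1)) := by fun_prop
    rw [lintegral_map hG measurable_swap, acceptedLaw_eq_withDensity_volume hπ hq,
      lintegral_withDensity_eq_lintegral_mul _ hk
        (by fun_prop : Measurable fun p : S × S => G p.swap),
      lintegral_withDensity_eq_lintegral_mul _ hk hG, ← lintegral_prod_swap]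
    refine lintegral_congr fun p => ?_
    simp only [Pi.mul_apply, Prod.fst_swap, Prod.snd_swap, Prod.swap_swap]
    rw [min_comm]
  · rw [rejectedLaw, Measure.map_map measurable_swap (by fun_prop)]
    rfl

/-- By detailed balance the second marginal of two consecutive states equals the first. -/
lemma measurePreserving_step (hπ : IsProbDensity π) (hq : IsProbDensity q) :
    MeasurePreserving (step π q) ((law π).prod (innovationLaw q)) (law π) := by
  have := hπ.isProbabilityMeasure
  have := hq.isProbabilityMeasure
  have hs := measurable_step hπ.measurable hq.measurable
  have hj : Measurable fun p : S × (S × unitInterval) => (p.1, step π q p) := by fun_prop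
  refine ⟨hs, ?_⟩
  have h := congrArg (Measure.map Prod.fst) (map_swap_map_step hπ hq)
  rw [Measure.map_map measurable_fst measurable_swap, Measure.map_map (by fun_prop) hj,
    Measure.map_map (by fun_prop) hj] at h
  exact h.trans measurePreserving_fst.map_eq

/-- Expectations of products over two consecutive states. -/
lemma integral_mul_transOp (hπ : IsProbDensity π) (hq : IsProbDensity q) {f g : S → ℝ}
    (hf : Measurable f) (hg : Measurable g) (hf2 : MemLp f 2 (law π)) (hg2 : MemLp g 2 (law π)) :
    Integrable (fun p : S × S => f p.1 * g p.2)
        (((law π).prod (innovationLaw q)).map fun p => (p.1, step π q p)) ∧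
      ∫ x, f x * transOp (innovationLaw q) (step π q) g x ∂(law π) =
        ∫ p, f p.1 * g p.2 ∂(((law π).prod (innovationLaw q)).map fun p => (p.1, step π q p)) := by
  have := hπ.isProbabilityMeasure
  have := hq.isProbabilityMeasure
  have hs := measurePreserving_step hπ hq
  have hj : Measurable fun p : S × (S × unitInterval) => (p.1, step π q p) :=
    measurable_fst.prodMk hs.measurable
  have hm : Measurable fun p : S × S => f p.1 * g p.2 := by fun_prop
  have hint : Integrable (fun p : S × (S × unitInterval) => f p.1 * g (step π q p))
      ((law π).prod (innovationLaw q)) :=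
    (hf2.comp_measurePreserving measurePreserving_fst).integrable_mul
      (hg2.comp_measurePreserving hs)
  refine ⟨(integrable_map_measure hm.aestronglyMeasurable hj.aemeasurable).2 hint, ?_⟩
  rw [integral_map hj.aemeasurable hm.aestronglyMeasurable, integral_prod _ hint]
  simp only [integral_const_mul]
  rfl

lemma integral_mul_transOp_comm (hπ : IsProbDensity π) (hq : IsProbDensity q) {f g : S → ℝ}
    (hf : Measurable f) (hg : Measurable g) (hf2 : MemLp f 2 (law π)) (hg2 : MemLp g 2 (law π)) :
    ∫ x, f x * transOp (innovationLaw q) (step π q) g x ∂(law π) =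
      ∫ x, g x * transOp (innovationLaw q) (step π q) f x ∂(law π) := by
  rw [(integral_mul_transOp hπ hq hf hg hf2 hg2).2, (integral_mul_transOp hπ hq hg hf hg2 hf2).2]
  conv_lhs => rw [← map_swap_map_step hπ hq]
  have hm : Measurable fun p : S × S => f p.1 * g p.2 := by fun_prop
  rw [integral_map measurable_swap.aemeasurable hm.aestronglyMeasurable]
  simp only [Prod.fst_swap, Prod.snd_swap, mul_comm]

/-- The independent Metropolis kernel is a positive operator on `L²(π)`. -/
lemma integral_mul_transOp_nonneg (hπ : IsProbDensity π) (hq : IsProbDensity q) {f : S → ℝ}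
    (hf : Measurable f) (hf2 : MemLp f 2 (law π)) :
    0 ≤ ∫ x, f x * transOp (innovationLaw q) (step π q) f x ∂(law π) := by
  have hπm := hπ.measurable
  have hqm := hq.measurable
  obtain ⟨hint, e⟩ := integral_mul_transOp hπ hq hf hf hf2 hf2
  rw [map_step_eq hπ hq] at hint e
  have hA := hint.left_of_add_measure
  rw [e, integral_add_measure hA hint.right_of_add_measure]
  have hm : Measurable fun p : S × S => f p.1 * f p.2 := by fun_prop
  have hk : Measurable fun p : S × S =>
      ENNReal.ofReal (min (q p.1 / π p.1) (q p.2 / π p.2)) := by fun_prop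
  have hρ (x : S) : 0 ≤ q x / π x := div_nonneg (hq.nonneg x) (hπ.nonneg x)
  refine add_nonneg ?_ ?_
  · rw [acceptedLaw_eq_withDensity_law hπ hq] at hA ⊢
    rw [integral_withDensity_eq_integral_toReal_smul hk
      (Eventually.of_forall fun _ => ENNReal.ofReal_lt_top)]
    rw [integrable_withDensity_iff_integrable_smul' hk
      (Eventually.of_forall fun _ => ENNReal.ofReal_lt_top)] at hA
    simp only [ENNReal.toReal_ofReal (le_min (hρ _) (hρ _)), smul_eq_mul] at hA ⊢
    exact integral_min_mul_nonneg (ρ := fun x => q x / π x) (by fun_prop) hρ hf hA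
  · rw [rejectedLaw, integral_map (by fun_prop) hm.aestronglyMeasurable]
    exact integral_nonneg fun p => mul_self_nonneg _

end Kernel

/-! ### From Kullback-Leibler divergence to rejection probability. -/

/-- The squared Hellinger integrand is dominated by the Kullback-Leibler integrand. -/
lemma sq_sqrt_sub_one_le_klFun {x : ℝ} (hx : 0 ≤ x) :
    (√x - 1) ^ 2 ≤ InformationTheory.klFun x := by
  rcases hx.eq_or_lt with rfl | hx
  · simp [InformationTheory.klFun_zero]
  set s := √x with hs
  have hs0 : 0 < s := Real.sqrt_pos.2 hx
  have hxs : x = s ^ 2 := (Real.sq_sqrt hx.le).symm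
  -- With `x = s²`, the difference of the two sides is exactly `2 s klFun s`.
  have h := mul_nonneg hs0.le (InformationTheory.klFun_nonneg hs0.le)
  rw [InformationTheory.klFun_apply] at h ⊢
  rw [hxs, Real.log_pow]
  push_cast
  nlinarith

section RelativeDensity

variable {S : Type*} [MeasureSpace S] {π q : S → ℝ}

/-- The quotient is `0` where `π` vanishes, so the formula needs `q` to vanish almost everywhere
there; absolute continuity provides this. -/
lemma law_eq_withDensity_div (hπ : IsProbDensity π) (hq : IsProbDensity q)
    (hac : law q ≪ law π) :
    law q = (law π).withDensity fun x => ENNReal.ofReal (q x / π x) := by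
  have hπm := hπ.measurable
  have hqm := hq.measurable
  have hnull : law q {x | π x = 0} = 0 := by
    refine hac ?_
    rw [law, withDensity_apply_eq_zero hπm.ennreal_ofReal]
    convert measure_empty (μ := (volume : Measure S))
    ext x
    simp +contextual [ne_of_gt]
  rw [law, withDensity_apply_eq_zero hqm.ennreal_ofReal] at hnull
  rw [law, law, ← withDensity_mul _ hπm.ennreal_ofReal (by fun_prop)]
  refine withDensity_congr_ae ?_
  filter_upwards [measure_eq_zero_iff_ae_notMem.1 hnull] with x hx
  simp only [Pi.mul_apply]
  rw [← ENNReal.ofReal_mul (hπ.nonneg x)]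
  rcases (hπ.nonneg x).eq_or_lt with h0 | h0
  · have : ENNReal.ofReal (q x) = 0 := by
      by_contra hne
      exact hx ⟨hne, h0.symm⟩
    rw [this, ← h0, zero_mul, ENNReal.ofReal_zero]
  · rw [mul_div_cancel₀ _ h0.ne']

/-- A total variation bound in terms of the Kullback-Leibler divergence. -/
lemma integral_abs_div_sub_one_le (hπ : IsProbDensity π) (hq : IsProbDensity q) {δ : ℝ}
    (hδ : 0 ≤ δ) (hkl : InformationTheory.klDiv (law q) (law π) ≤ ENNReal.ofReal δ) :
    Integrable (fun x => |q x / π x - 1|) (law π) ∧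
      ∫ x, |q x / π x - 1| ∂(law π) ≤ 2 * √δ := by
  have := hπ.isProbabilityMeasure
  have := hq.isProbabilityMeasure
  have hπm := hπ.measurable
  have hqm := hq.measurable
  have hac : law q ≪ law π :=
    (InformationTheory.klDiv_ne_top_iff.1 (ne_top_of_le_ne_top ENNReal.ofReal_ne_top hkl)).1
  have hlaw := law_eq_withDensity_div hπ hq hac
  set r : S → ℝ := fun x => q x / π x with hr
  have hrm : Measurable r := by fun_prop
  have hr0 (x) : 0 ≤ r x := div_nonneg (hq.nonneg x) (hπ.nonneg x)
  have hrn : (law q).rnDeriv (law π) =ᵐ[law π] fun x => ENNReal.ofReal (r x) := by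
    rw [hlaw]
    exact Measure.rnDeriv_withDensity _ hrm.ennreal_ofReal
  have hhel : ∫⁻ x, ENNReal.ofReal ((√(r x) - 1) ^ 2) ∂(law π) ≤ ENNReal.ofReal δ := by
    refine le_trans ?_ hkl
    rw [InformationTheory.klDiv_eq_lintegral_klFun_of_ac hac]
    refine lintegral_mono_ae ?_
    filter_upwards [hrn] with x hx
    rw [hx, ENNReal.toReal_ofReal (hr0 x)]
    exact ENNReal.ofReal_le_ofReal (sq_sqrt_sub_one_le_klFun (hr0 x))
  have hone : ∫⁻ x, ENNReal.ofReal (r x) ∂(law π) = 1 := by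
    have := measure_univ (μ := law q)
    rwa [hlaw, withDensity_apply _ MeasurableSet.univ, Measure.restrict_univ] at this
  have hrI : Integrable r (law π) := by
    refine (lintegral_ofReal_ne_top_iff_integrable hrm.aestronglyMeasurable
      (Eventually.of_forall hr0)).1 ?_
    rw [hone]; exact ENNReal.one_ne_top
  have hr1 : ∫ x, r x ∂(law π) = 1 := by
    rw [integral_eq_lintegral_of_nonneg_ae (Eventually.of_forall hr0) hrm.aestronglyMeasurable,
      hone, ENNReal.toReal_one]
  have hdI : Integrable (fun x => (√(r x) - 1) ^ 2) (law π) :=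
    (lintegral_ofReal_ne_top_iff_integrable (by fun_prop)
      (Eventually.of_forall fun x => sq_nonneg _)).1
      (ne_top_of_le_ne_top ENNReal.ofReal_ne_top hhel)
  have hd : ∫ x, (√(r x) - 1) ^ 2 ∂(law π) ≤ δ := by
    rw [integral_eq_lintegral_of_nonneg_ae (Eventually.of_forall fun x => sq_nonneg _)
      (by fun_prop)]
    exact ENNReal.toReal_le_of_le_ofReal hδ hhel
  have hd2 : MemLp (fun x => |√(r x) - 1|) 2 (law π) := by
    refine (memLp_two_iff_integrable_sq (by fun_prop)).2 ?_
    simpa only [sq_abs] using hdI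
  have hb : ∀ x, (√(r x) + 1) ^ 2 ≤ 2 * r x + 2 := fun x => by
    nlinarith [Real.sq_sqrt (hr0 x), sq_nonneg (√(r x) - 1)]
  have hsI : Integrable (fun x => 2 * r x + 2) (law π) :=
    (hrI.const_mul 2).add (integrable_const _)
  have hs2 : MemLp (fun x => √(r x) + 1) 2 (law π) := by
    refine (memLp_two_iff_integrable_sq (by fun_prop)).2 (hsI.mono' (by fun_prop)
      (Eventually.of_forall fun x => ?_))
    rw [Real.norm_of_nonneg (sq_nonneg _)]
    exact hb x
  have hs : ∫ x, (√(r x) + 1) ^ 2 ∂(law π) ≤ 4 := by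
    refine (integral_mono hs2.integrable_sq hsI hb).trans_eq ?_
    rw [integral_add (hrI.const_mul 2) (integrable_const _), integral_const_mul, hr1]
    simp
    norm_num
  -- Cauchy-Schwarz on this factorization pairs the squared Hellinger integral, at most `δ`, with a
  -- factor at most `4`.
  have hfac (x) : |r x - 1| = |√(r x) - 1| * (√(r x) + 1) := by
    rw [← abs_of_nonneg (by positivity : 0 ≤ √(r x) + 1), ← abs_mul]
    congr 1
    nlinarith [Real.sq_sqrt (hr0 x)]
  refine ⟨(hrI.sub (integrable_const 1)).abs, ?_⟩
  have hcs := sq_integral_mul_le hd2 hs2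
  simp only [← hfac, sq_abs] at hcs
  refine abs_le_of_sq_le_sq' ?_ (by positivity) |>.2
  rw [mul_pow, Real.sq_sqrt hδ]
  have := mul_le_mul hd hs (integral_nonneg fun x => sq_nonneg _) hδ
  linarith

/-- The rejection probability is small when the Kullback-Leibler divergence is small. -/
lemma integral_one_sub_accept_le [SFinite (volume : Measure S)] (hπ : IsProbDensity π)
    (hq : IsProbDensity q) {δ : ℝ} (hδ : 0 ≤ δ)
    (hkl : InformationTheory.klDiv (law q) (law π) ≤ ENNReal.ofReal δ) :
    ∫ p, (1 - accept π q p.1 p.2) ∂((law π).prod (law q)) ≤ 4 * √δ := by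
  have := hπ.isProbabilityMeasure
  have := hq.isProbabilityMeasure
  have hπm := hπ.measurable
  have hqm := hq.measurable
  obtain ⟨hI, hle⟩ := integral_abs_div_sub_one_le hπ hq hδ hkl
  have hac : law q ≪ law π :=
    (InformationTheory.klDiv_ne_top_iff.1 (ne_top_of_le_ne_top ENNReal.ofReal_ne_top hkl)).1
  have hk : Measurable fun p : S × S => ENNReal.ofReal (q p.2 / π p.2) := by fun_prop
  have hr0 (x) : 0 ≤ q x / π x := div_nonneg (hq.nonneg x) (hπ.nonneg x)
  -- With `r = q/π`, the left side is the positive part of `r y - r x` when both densities are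
  -- positive. The factor `r y` arises from integrating the proposal under `π` instead of `q`.
  have hpt (p : S × S) : q p.2 / π p.2 * (1 - accept π q p.1 p.2) ≤
      |q p.1 / π p.1 - 1| + |q p.2 / π p.2 - 1| := by
    rcases (hπ.nonneg p.1).eq_or_lt with h1 | h1
    · have : accept π q p.1 p.2 = 1 := by simp [accept, ← h1]
      rw [this, sub_self, mul_zero]
      positivity
    rcases (hπ.nonneg p.2).eq_or_lt with h2 | h2
    · rw [← h2, div_zero, zero_mul]
      positivity
    have e : q p.2 / π p.2 * (1 - accept π q p.1 p.2) =
        q p.2 / π p.2 - min (q p.2 / π p.2) (q p.1 / π p.1) := by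
      have hm := mul_accept hπ.nonneg hq.nonneg p.1 p.2
      have e1 : π p.1 * q p.2 = π p.1 * π p.2 * (q p.2 / π p.2) := by field_simp
      have e2 : π p.2 * q p.1 = π p.1 * π p.2 * (q p.1 / π p.1) := by field_simp
      rw [e1, e2, ← mul_min_of_nonneg _ _ (mul_pos h1 h2).le, mul_assoc] at hm
      have := mul_left_cancel₀ (mul_pos h1 h2).ne' hm
      rw [mul_sub, this, mul_one]
    rw [e]
    have t1 := le_abs_self (q p.2 / π p.2 - 1)
    have t2 := neg_abs_le (q p.1 / π p.1 - 1)
    rcases min_choice (q p.2 / π p.2) (q p.1 / π p.1) with h | h <;> rw [h]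
    · rw [sub_self]; positivity
    · linarith
  have hI1 : Integrable (fun p : S × S => |q p.1 / π p.1 - 1|) ((law π).prod (law π)) :=
    measurePreserving_fst.integrable_comp_of_integrable hI
  have hI2 : Integrable (fun p : S × S => |q p.2 / π p.2 - 1|) ((law π).prod (law π)) :=
    measurePreserving_snd.integrable_comp_of_integrable hI
  rw [law_eq_withDensity_div hπ hq hac, prod_withDensity_right (by fun_prop),
    integral_withDensity_eq_integral_toReal_smul hk
      (Eventually.of_forall fun _ => ENNReal.ofReal_lt_top)]
  simp only [ENNReal.toReal_ofReal (hr0 _), smul_eq_mul]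
  refine (integral_mono_of_nonneg (Eventually.of_forall fun p =>
    mul_nonneg (hr0 _) (sub_nonneg.2 (accept_le_one _ _))) (hI1.add hI2)
    (Eventually.of_forall hpt)).trans ?_
  rw [integral_add' hI1 hI2]
  rw [integral_fun_fst (μ := law π) (ν := law π) (fun x => |q x / π x - 1|),
    integral_fun_snd (μ := law π) (ν := law π) (fun x => |q x / π x - 1|)]
  simp only [probReal_univ, one_smul]
  linarith

end RelativeDensity

/-! ### The two estimators as functionals of the chain. -/

section Chain

variable {S : Type*} [MeasureSpace S] {π q F : S → ℝ}

-- Identifies the iterated shift with the recursive algorithm, so that the general chain results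
-- apply.
omit [MeasureSpace S] in
lemma firstStep_iterate_chainShift (π q : S → ℝ) (i : ℕ) (ω : Noise S) :
    firstStep ((chainShift (step π q))^[i] ω) = (state π q i ω, ω.2 i) := by
  have htail (i : ℕ) (ω : Noise S) (n : ℕ) :
      ((chainShift (step π q))^[i] ω).2 n = ω.2 (n + i) := by
    induction i generalizing n with
    | zero => rfl
    | succ i ih =>
      rw [Function.iterate_succ_apply']
      simp only [chainShift, ih, add_assoc, add_comm 1 i]
  have hstate : ((chainShift (step π q))^[i] ω).1 = state π q i ω := by
    induction i with
    | zero => rfl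
    | succ i ih =>
      rw [Function.iterate_succ_apply']
      simp only [chainShift, firstStep, ih, htail, zero_add]
      rfl
  rw [firstStep, hstate, htail, zero_add]

/-- The summand of the control variate estimator, up to the constant `𝔼_q[F]`. -/
def cvTerm (π q F : S → ℝ) (p : S × S) : ℝ := (1 - accept π q p.1 p.2) * (F p.1 - F p.2)

lemma abs_cvTerm_le (hπ : IsProbDensity π) (hq : IsProbDensity q) (p : S × S) :
    |cvTerm π q F p| ≤ |F p.1 - F p.2| := by
  have h0 := accept_nonneg hπ.nonneg hq.nonneg p.1 p.2
  have h1 := accept_le_one (π := π) (q := q) p.1 p.2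
  rw [cvTerm, abs_mul, abs_of_nonneg (sub_nonneg.2 h1)]
  exact mul_le_of_le_one_left (abs_nonneg _) (by linarith)

lemma measurable_cvTerm (hπ : IsProbDensity π) (hq : IsProbDensity q) (hF : Measurable F) :
    Measurable (cvTerm π q F) := by
  have : Measurable fun p : S × S => accept π q p.1 p.2 :=
    measurable_accept hπ.measurable hq.measurable
  unfold cvTerm
  fun_prop

lemma memLp_cvTerm (hπ : IsProbDensity π) (hq : IsProbDensity q) (hF : Measurable F)
    (hFπ : MemLp F 2 (law π)) (hFq : MemLp F 2 (law q)) :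
    MemLp (cvTerm π q F) 2 ((law π).prod (law q)) := by
  have := hπ.isProbabilityMeasure
  have := hq.isProbabilityMeasure
  exact ((hFπ.comp_measurePreserving measurePreserving_fst).sub
    (hFq.comp_measurePreserving measurePreserving_snd)).mono
    (measurable_cvTerm hπ hq hF).aestronglyMeasurable
    (Eventually.of_forall fun p => abs_cvTerm_le hπ hq p)

/-- The second moment of the control variate summand is controlled by the rejection probability and
by the fourth moments. -/
lemma sq_integral_cvTerm_sq_le (hπ : IsProbDensity π) (hq : IsProbDensity q) (hF : Measurable F)
    (hFπ : Integrable (fun x => F x ^ 4) (law π)) (hFq : Integrable (fun x => F x ^ 4) (law q)) :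
    (∫ p, cvTerm π q F p ^ 2 ∂((law π).prod (law q))) ^ 2 ≤
      (∫ p, (1 - accept π q p.1 p.2) ∂((law π).prod (law q))) *
        (8 * (expect π (fun x => F x ^ 4) + expect q (fun x => F x ^ 4))) := by
  have := hπ.isProbabilityMeasure
  have := hq.isProbabilityMeasure
  have hαm : Measurable fun p : S × S => accept π q p.1 p.2 :=
    measurable_accept hπ.measurable hq.measurable
  have h0 (p : S × S) : 0 ≤ accept π q p.1 p.2 := accept_nonneg hπ.nonneg hq.nonneg p.1 p.2
  have h1 (p : S × S) : accept π q p.1 p.2 ≤ 1 := accept_le_one p.1 p.2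
  have hI1 : Integrable (fun p : S × S => F p.1 ^ 4) ((law π).prod (law q)) :=
    measurePreserving_fst.integrable_comp_of_integrable hFπ
  have hI2 : Integrable (fun p : S × S => F p.2 ^ 4) ((law π).prod (law q)) :=
    measurePreserving_snd.integrable_comp_of_integrable hFq
  have h8 (p : S × S) : ((F p.1 - F p.2) ^ 2) ^ 2 ≤ 8 * (F p.1 ^ 4 + F p.2 ^ 4) := by
    have e1 : (F p.1 - F p.2) ^ 2 ≤ 2 * (F p.1 ^ 2 + F p.2 ^ 2) := by
      nlinarith [sq_nonneg (F p.1 + F p.2)]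
    have e2 := pow_le_pow_left₀ (sq_nonneg _) e1 2
    nlinarith [sq_nonneg (F p.1 ^ 2 - F p.2 ^ 2)]
  have hI8 := (hI1.fun_add hI2).const_mul 8
  have hG : MemLp (fun p : S × S => (F p.1 - F p.2) ^ 2) 2 ((law π).prod (law q)) := by
    refine (memLp_two_iff_integrable_sq (by fun_prop)).2 (hI8.mono' (by fun_prop)
      (Eventually.of_forall fun p => ?_))
    rw [Real.norm_of_nonneg (sq_nonneg _)]
    exact h8 p
  have hAle (p : S × S) : ((1 - accept π q p.1 p.2) ^ 2) ^ 2 ≤ 1 - accept π q p.1 p.2 := by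
    rw [← pow_mul]
    exact pow_le_of_le_one (sub_nonneg.2 (h1 p)) (by linarith [h0 p]) (by norm_num)
  have hAI : Integrable (fun p : S × S => 1 - accept π q p.1 p.2) ((law π).prod (law q)) :=
    (integrable_const (1 : ℝ)).mono' (by fun_prop) (Eventually.of_forall fun p => by
      rw [Real.norm_of_nonneg (sub_nonneg.2 (h1 p))]; linarith [h0 p])
  have hA : MemLp (fun p : S × S => (1 - accept π q p.1 p.2) ^ 2) 2 ((law π).prod (law q)) := by
    refine (memLp_two_iff_integrable_sq (by fun_prop)).2 (hAI.mono' (by fun_prop)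
      (Eventually.of_forall fun p => ?_))
    rw [Real.norm_of_nonneg (sq_nonneg _)]
    exact hAle p
  -- The factors are `(1 - α)²` and `(F x - F y)²`. Squared again, the first is at most `1 - α`
  -- since `0 ≤ 1 - α ≤ 1`, the second at most `8 (F x ^ 4 + F y ^ 4)`.
  have hcs := sq_integral_mul_le hA hG
  simp only [← mul_pow] at hcs
  refine hcs.trans (mul_le_mul (integral_mono hA.integrable_sq hAI hAle) ?_
    (integral_nonneg fun p => sq_nonneg _) (integral_nonneg fun p => sub_nonneg.2 (h1 p)))
  refine (integral_mono hG.integrable_sq hI8 h8).trans_eq ?_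
  rw [integral_const_mul, integral_add hI1 hI2,
    integral_fun_fst (μ := law π) (ν := law q) (fun x => F x ^ 4),
    integral_fun_snd (μ := law π) (ν := law q) (fun x => F x ^ 4)]
  simp only [probReal_univ, one_smul, expect]

variable [SFinite (volume : Measure S)]

/-- The asymptotic variance of the control variate estimator exists and is bounded by the second
moment of its summands. -/
lemma exists_isSigmaSqIMCV (hπ : IsProbDensity π) (hq : IsProbDensity q) {w : ℝ≥0} (hw1 : 1 < w)
    (hw : ∀ x, π x ≤ w * q x) (hF : Measurable F) (hFπ : MemLp F 2 (law π))
    (hFq : MemLp F 2 (law q)) :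
    ∃ s, IsSigmaSqIMCV π q F s ∧
      s ≤ (1 + 2 * w) * ∫ p, cvTerm π q F p ^ 2 ∂((law π).prod (law q)) := by
  have := hπ.isProbabilityMeasure
  have := hq.isProbabilityMeasure
  have hs := measurePreserving_step hπ hq
  have hpr : MeasurePreserving (fun p : S × (S × unitInterval) => (p.1, p.2.1))
      ((law π).prod (innovationLaw q)) ((law π).prod (law q)) :=
    (MeasurePreserving.id _).prod measurePreserving_fst
  have hcm := measurable_cvTerm hπ hq hF
  have hc2 := memLp_cvTerm hπ hq hF hFπ hFq
  set m := ∫ p, cvTerm π q F p ∂((law π).prod (law q)) with hm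
  set h : S × (S × unitInterval) → ℝ := fun p => cvTerm π q F (p.1, p.2.1) - m with hh
  have hhm : Measurable h := by fun_prop
  have hpush {g : S × S → ℝ} (hg : Measurable g) :
      ∫ p, g (p.1, p.2.1) ∂((law π).prod (innovationLaw q)) =
        ∫ p, g p ∂((law π).prod (law q)) := by
    conv_rhs => rw [← hpr.map_eq, integral_map hpr.aemeasurable hg.aestronglyMeasurable]
  have hc2' : MemLp (fun p : S × (S × unitInterval) => cvTerm π q F (p.1, p.2.1)) 2
      ((law π).prod (innovationLaw q)) := hc2.comp_measurePreserving hpr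
  have hh2 : MemLp h 2 ((law π).prod (innovationLaw q)) := hc2'.sub (memLp_const m)
  have hh0 : ∫ p, h p ∂((law π).prod (innovationLaw q)) = 0 := by
    have e := integral_sub (hc2'.integrable one_le_two) (integrable_const m)
    rw [hpush hcm] at e
    simpa [hm] using e
  obtain ⟨L, hL, hLle, -⟩ := exists_tendsto_sq_sum hs hw1
    (law_le_smul_map_step hπ hq hw) hhm hh2 hh0
  refine ⟨L, ?_, hLle.trans ?_⟩
  · refine hL.congr' ?_
    filter_upwards [eventually_gt_atTop 0] with n hn
    have hn' : (0 : ℝ) < n := by exact_mod_cast hn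
    set H : ℕ → Noise S → ℝ := fun i ω => h (firstStep ((chainShift (step π q))^[i] ω)) with hH
    have hH2 (i) : MemLp (H i) 2 (noiseLaw π q) := memLp_lag hs hh2 i
    have hHi (i) : ∫ ω, H i ω ∂(noiseLaw π q) = 0 := by
      have hlag := measurePreserving_lag (μ := law π) (ν := innovationLaw q) hs i
      rw [← hh0, ← hlag.map_eq, integral_map hlag.aemeasurable hhm.aestronglyMeasurable]
      rfl
    have hS2 : MemLp (fun ω => ∑ i ∈ Finset.range n, H i ω) 2 (noiseLaw π q) :=
      memLp_finsetSum _ fun i _ => hH2 i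
    have hS0 : ∫ ω, ∑ i ∈ Finset.range n, H i ω ∂(noiseLaw π q) = 0 := by
      have : IsProbabilityMeasure (noiseLaw π q) := by unfold noiseLaw; infer_instance
      rw [integral_finsetSum _ fun i _ => (hH2 i).integrable one_le_two]
      exact Finset.sum_eq_zero fun i _ => hHi i
    -- The random terms collapse: `F X + α (F Y - F X) - F Y = (1 - α) (F X - F Y)`.
    have hest : imcvEstimator π q F n = fun ω =>
        (1 / n : ℝ) * ∑ i ∈ Finset.range n, H i ω + (m + expect q F) := by
      ext ω
      have e (i) : F (state π q i ω) +
          (accept π q (state π q i ω) (proposal i ω) * (F (proposal i ω) - F (state π q i ω)) -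
          (F (proposal i ω) - expect q F)) = H i ω + (m + expect q F) := by
        simp only [hH, firstStep_iterate_chainShift, hh, cvTerm, proposal]
        ring
      simp only [imcvEstimator, e, Finset.sum_add_distrib, Finset.sum_const, Finset.card_range,
        nsmul_eq_mul]
      field_simp
    have : IsProbabilityMeasure (noiseLaw π q) := by unfold noiseLaw; infer_instance
    rw [variance_const_mul, Real.sq_sqrt hn'.le, hest,
      variance_add_const (hS2.aestronglyMeasurable.const_mul _), variance_const_mul,
      variance_of_integral_eq_zero hS2.aemeasurable hS0]
    change (n : ℝ)⁻¹ * ∫ ω, (∑ i ∈ Finset.range n, H i ω) ^ 2 ∂(noiseLaw π q) = _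
    field_simp
  · have hcI := hc2'.integrable one_le_two
    have e : ∫ p, h p ^ 2 ∂((law π).prod (innovationLaw q)) =
        ∫ p, cvTerm π q F p ^ 2 ∂((law π).prod (law q)) - m ^ 2 := by
      rw [← hpush (hcm.pow_const 2)]
      have hexp (p : S × (S × unitInterval)) : h p ^ 2 =
          cvTerm π q F (p.1, p.2.1) ^ 2 + ((-2 * m) * cvTerm π q F (p.1, p.2.1) + m ^ 2) := by
        simp only [hh]; ring
      simp only [hexp]
      rw [integral_add hc2'.integrable_sq ((hcI.const_mul _).fun_add (integrable_const _)),
        integral_add (hcI.const_mul _) (integrable_const _), integral_const_mul]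
      simp only [hpush hcm, ← hm, integral_const, probReal_univ, one_smul]
      ring
    rw [e]
    gcongr
    linarith [sq_nonneg m]

/-- The asymptotic variance of the ergodic average exists and is at least the variance of i.i.d.
sampling. -/
lemma exists_isSigmaSqIM (hπ : IsProbDensity π) (hq : IsProbDensity q) {w : ℝ≥0} (hw1 : 1 < w)
    (hw : ∀ x, π x ≤ w * q x) (hF : Measurable F) (hFπ : MemLp F 2 (law π)) :
    ∃ s, IsSigmaSqIM π q F s ∧ sigmaSqF π F ≤ s := by
  have := hπ.isProbabilityMeasure
  have := hq.isProbabilityMeasure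
  have hs := measurePreserving_step hπ hq
  set m := expect π F with hm
  set f : S → ℝ := fun x => F x - m with hf
  have hfm : Measurable f := by fun_prop
  have hf2 : MemLp f 2 (law π) := hFπ.sub (memLp_const m)
  have hf0 : ∫ x, f x ∂(law π) = 0 := by
    rw [integral_sub (hFπ.integrable one_le_two) (integrable_const m)]
    simp [hm, expect]
  have hfm' : Measurable fun p : S × (S × unitInterval) => f p.1 := by fun_prop
  obtain ⟨L, hL, -, hLge⟩ := exists_tendsto_sq_sum hs hw1 (law_le_smul_map_step hπ hq hw) hfm'
    (hf2.comp_measurePreserving measurePreserving_fst)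
    (by rw [integral_fun_fst]; simp [hf0])
  refine ⟨L, hL.congr' ?_, ?_⟩
  · filter_upwards [eventually_gt_atTop 0] with n hn
    have hn' : (0 : ℝ) < n := by exact_mod_cast hn
    have e (ω : Noise S) : (imEstimator π q F n ω - m) ^ 2 = ((n : ℝ)⁻¹) ^ 2 *
        (∑ i ∈ Finset.range n, f (firstStep ((chainShift (step π q))^[i] ω)).1) ^ 2 := by
      rw [← mul_pow]
      congr 1
      simp only [imEstimator, firstStep_iterate_chainShift, hf, Finset.sum_sub_distrib,
        Finset.sum_const, Finset.card_range, nsmul_eq_mul]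
      field_simp
    rw [integral_congr_ae (Eventually.of_forall e), integral_const_mul]
    change (n : ℝ)⁻¹ * ∫ ω, (∑ i ∈ Finset.range n,
      f (firstStep ((chainShift (step π q))^[i] ω)).1) ^ 2 ∂(noiseLaw π q) = _
    field_simp
  · refine le_trans (le_of_eq ?_) (hLge fun k => lagCov_succ_nonneg hs
      (fun _ _ hf hg hf2 hg2 => integral_mul_transOp_comm hπ hq hf hg hf2 hg2)
      (fun _ hf hf2 => integral_mul_transOp_nonneg hπ hq hf hf2) hfm hf2 k)
    rw [integral_fun_fst (fun x => f x ^ 2)]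
    simp [sigmaSqF, hf, hm]

omit [SFinite (volume : Measure S)] in
/-- If `F` is almost surely constant, then the summands of the control variate estimator are almost
surely constant. -/
lemma integral_cvTerm_sq_eq_zero (hπ : IsProbDensity π) (hq : IsProbDensity q)
    (hFπ : MemLp F 2 (law π)) (hac : law q ≪ law π) (h0 : sigmaSqF π F = 0) :
    ∫ p, cvTerm π q F p ^ 2 ∂((law π).prod (law q)) = 0 := by
  have := hπ.isProbabilityMeasure
  have := hq.isProbabilityMeasure
  have hI : Integrable (fun x => (F x - expect π F) ^ 2) (law π) :=
    (hFπ.sub (memLp_const _)).integrable_sq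
  have hae : ∀ᵐ x ∂(law π), F x = expect π F := by
    have := (integral_eq_zero_iff_of_nonneg (fun x => sq_nonneg _) hI).1 h0
    filter_upwards [this] with x hx
    exact sub_eq_zero.1 (pow_eq_zero_iff two_ne_zero |>.1 hx)
  refine integral_eq_zero_of_ae ?_
  filter_upwards [measurePreserving_fst.quasiMeasurePreserving.ae hae,
    measurePreserving_snd.quasiMeasurePreserving.ae (hac.ae_le hae)] with p h1 h2
  simp [cvTerm, h1, h2]

end Chain

/-! ### Moment bounds from the weight, and the main theorem. -/

lemma integrable_pow_four_of_memWeightedSup {S : Type*} [MeasurableSpace S] {ν : Measure S}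
    {F W : S → ℝ} (hF : Measurable F) (hW : ∀ x, 1 ≤ W x)
    (hb : BddAbove (Set.range fun x => |F x| / W x)) (hI : Integrable (fun x => |W x| ^ 4) ν) :
    Integrable (fun x => F x ^ 4) ν := by
  obtain ⟨c, hc⟩ := hb
  refine (hI.const_mul (c ^ 4)).mono' (by fun_prop) (Eventually.of_forall fun x => ?_)
  have hWx : 0 < W x := zero_lt_one.trans_le (hW x)
  have h : |F x| ≤ c * |W x| := by
    rw [abs_of_pos hWx, ← div_le_iff₀ hWx]
    exact hc ⟨x, rfl⟩
  rw [Real.norm_eq_abs, abs_pow, ← mul_pow]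
  exact pow_le_pow_left₀ (abs_nonneg _) h 4

lemma memLp_two_of_integrable_pow_four {S : Type*} [MeasurableSpace S] {ν : Measure S}
    [IsFiniteMeasure ν] {F : S → ℝ} (hF : Measurable F) (hI : Integrable (fun x => F x ^ 4) ν) :
    MemLp F 2 ν := by
  refine (memLp_two_iff_integrable_sq hF.aestronglyMeasurable).2
    ((hI.add (integrable_const 1)).mono' (by fun_prop) (Eventually.of_forall fun x => ?_))
  rw [Real.norm_of_nonneg (sq_nonneg _)]
  simp only [Pi.add_apply]
  nlinarith [sq_nonneg (F x ^ 2 - 1)]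

lemma le_mul_of_wStar_le {S : Type*} [MeasureSpace S] {π q : S → ℝ} (hq : ∀ x, 0 ≤ q x) {w : ℝ≥0}
    (hw : wStar π q ≤ w) (x : S) : π x ≤ w * q x := by
  have h := (le_iSup (fun x => ENNReal.ofReal (π x) / ENNReal.ofReal (q x)) x).trans hw
  rw [ENNReal.div_le_iff_le_mul (Or.inr ENNReal.coe_ne_top) (Or.inl ENNReal.ofReal_ne_top),
    ← ENNReal.ofReal_coe_nnreal, ← ENNReal.ofReal_mul w.coe_nonneg] at h
  exact (ENNReal.ofReal_le_ofReal_iff (mul_nonneg w.coe_nonneg (hq x))).1 h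

end

end IndepMetropolis

open IndepMetropolis in
theorem theorem2 (w C : ℝ≥0) :
    ∃ K : ℝ, 0 ≤ K ∧ ∀ v : ℝ, ∃ ε : ℝ, 0 < ε ∧
      ∀ (d : ℕ) (X : Set (EuclideanSpace ℝ (Fin d))), MeasurableSet X →
      ∀ π q F W : X → ℝ,
        IsProbDensity π → IsProbDensity q →
        IsErgodicIM π q →
        (∀ x, 1 ≤ W x) → MemWeightedSup W F → MemLBoth 4 π q W →
        wStar π q ≤ w →
        expect π (fun x => F x ^ 4) ≤ C → expect q (fun x => F x ^ 4) ≤ C →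
        sigmaSqF π F = v →
        ∃ sIMCV sIM : ℝ, IsSigmaSqIMCV π q F sIMCV ∧ IsSigmaSqIM π q F sIM ∧
          (∀ δ : ℝ, 0 ≤ δ →
            InformationTheory.klDiv (law q) (law π) ≤ ENNReal.ofReal δ →
              sIMCV ≤ K * δ ^ (1 / 4 : ℝ)) ∧
          (InformationTheory.klDiv (law q) (law π) ≤ ENNReal.ofReal ε →
            sIMCV ≤ sigmaSqF π F ∧ sigmaSqF π F ≤ sIM) := by
  -- The factor `8 √C` is such that `8 √C δ^(1/4)` is the square root of `4 √δ · 8 (C + C)`.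
  -- Replacing `w` by `w + 2` keeps the upper bound and makes it exceed `1` strictly.
  have hK : (0 : ℝ) ≤ (1 + 2 * ((w + 2 : ℝ≥0) : ℝ)) * (8 * √(C : ℝ)) := by positivity
  set K : ℝ := (1 + 2 * ((w + 2 : ℝ≥0) : ℝ)) * (8 * √(C : ℝ)) with hKdef
  refine ⟨K, hK, fun v => ?_⟩
  -- For `v > 0`, `ε` solves `ε^(1/4) = v / (K + 1)`; the `+ 1` covers `K = 0`. For `v ≤ 0` any
  -- positive value serves.
  obtain ⟨ε, hε, hεv⟩ : ∃ ε : ℝ, 0 < ε ∧ (0 < v → K * ε ^ (1 / 4 : ℝ) ≤ v) := by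
    by_cases hv : 0 < v
    · refine ⟨(v / (K + 1)) ^ (4 : ℕ), by positivity, fun _ => ?_⟩
      have e : ((v / (K + 1)) ^ (4 : ℕ)) ^ (1 / 4 : ℝ) = v / (K + 1) := by
        have := Real.pow_rpow_inv_natCast (show 0 ≤ v / (K + 1) by positivity)
          (show (4 : ℕ) ≠ 0 by norm_num)
        simpa using this
      rw [e, mul_div_assoc', div_le_iff₀ (by positivity)]
      nlinarith
    · exact ⟨1, one_pos, fun h => absurd h hv⟩
  refine ⟨ε, hε, fun d X _ π q F W hπ hq _ hW1 hFW hW hwS hCπ hCq hv => ?_⟩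
  have := hπ.isProbabilityMeasure
  have := hq.isProbabilityMeasure
  have hF := hFW.1
  have hFπ4 := integrable_pow_four_of_memWeightedSup hF hW1 hFW.2 hW.2.1
  have hFq4 := integrable_pow_four_of_memWeightedSup hF hW1 hFW.2 hW.2.2
  have hFπ := memLp_two_of_integrable_pow_four hF hFπ4
  have hFq := memLp_two_of_integrable_pow_four hF hFq4
  have hw1 : 1 < w + 2 := lt_of_lt_of_le (by norm_num) (le_add_self : (2 : ℝ≥0) ≤ w + 2)
  have hw (x) : π x ≤ (w + 2 : ℝ≥0) * q x :=
    (le_mul_of_wStar_le hq.nonneg hwS x).trans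
      (mul_le_mul_of_nonneg_right (by push_cast; linarith) (hq.nonneg x))
  obtain ⟨s, hs, hsle⟩ := exists_isSigmaSqIMCV hπ hq hw1 hw hF hFπ hFq
  obtain ⟨t, ht, htge⟩ := exists_isSigmaSqIM hπ hq hw1 hw hF hFπ
  have hbound (δ : ℝ) (hδ : 0 ≤ δ)
      (hkl : InformationTheory.klDiv (law q) (law π) ≤ ENNReal.ofReal δ) :
      s ≤ K * δ ^ (1 / 4 : ℝ) := by
    refine hsle.trans ?_
    rw [hKdef, mul_assoc]
    refine mul_le_mul_of_nonneg_left ?_ (by positivity)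
    have h4 : 0 ≤ δ ^ (1 / 4 : ℝ) := Real.rpow_nonneg hδ _
    refine abs_le_of_sq_le_sq' ?_ (by positivity) |>.2
    have e : (8 * √(C : ℝ) * δ ^ (1 / 4 : ℝ)) ^ 2 = 4 * √δ * (8 * (C + C)) := by
      rw [mul_pow, mul_pow, Real.sq_sqrt C.coe_nonneg, ← Real.rpow_natCast (δ ^ (1 / 4 : ℝ)),
        ← Real.rpow_mul hδ, Real.sqrt_eq_rpow]
      norm_num
      ring
    rw [e]
    refine (sq_integral_cvTerm_sq_le hπ hq hF hFπ4 hFq4).trans ?_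
    have hnn (p : X → ℝ) : 0 ≤ expect p (fun x => F x ^ 4) :=
      integral_nonneg fun x => by positivity
    exact mul_le_mul (integral_one_sub_accept_le hπ hq hδ hkl)
      (by linarith) (by linarith [hnn π, hnn q]) (by positivity)
  refine ⟨s, t, hs, ht, hbound, fun hkl => ⟨?_, htge⟩⟩
  have hv0 : 0 ≤ sigmaSqF π F := integral_nonneg fun x => sq_nonneg _
  -- If `σ²_F = 0`, no rate in `δ` can help. Finite divergence gives `q ≪ π`, so `F` is the same
  -- constant almost surely under both laws and the summands vanish.
  rcases hv0.eq_or_lt with h0 | h0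
  · have hac : law q ≪ law π :=
      (InformationTheory.klDiv_ne_top_iff.1 (ne_top_of_le_ne_top ENNReal.ofReal_ne_top hkl)).1
    rwa [integral_cvTerm_sq_eq_zero hπ hq hFπ hac h0.symm, mul_zero, h0] at hsle
  · exact (hbound ε hε.le hkl).trans ((hεv (hv ▸ h0)).trans hv.ge)
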